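/- Let $d,m\ge 1$, let $T_1,\dots,T_m$ be invertible linear maps of $\mathbb R^d$ with Euclidean operator norms $\|T_i\|<1$, let $a_1,\dots,a_m\in\mathbb R^d$, and put $f_i(x)=T_ix+a_i$. For a linear map $T$ with singular values $\alpha_1\ge\dots\ge\alpha_d\ (>0)$ put $\phi^s(T)=\alpha_1\cdots\alpha_{r-1}\alpha_r^{\,s-r+1}$ if $0<s\le d$, where $r=\lceil s\rceil$, and $\phi^s(T)=(\alpha_1\cdots\alpha_d)^{s/d}$ if $s>d$. The affinity dimension is $$d(T_1,\dots,T_m)=\inf\Big\{s>0:\ \sum_{n=0}^\infty\ \sum_{(i_0,\dots,i_{n-1})\in\{1,\dots,m\}^n}\phi^s(T_{i_0}\cdots T_{i_{n-1}})<\infty\Big\}.$$ Let $\eta$ be a Borel probability measure on $\mathbb R^d$ that has a bounded density with respect to Lebesgue measure and whose tails decay super-polynomially: for every $k\in\mathbb N$ there is a constant $c_k$ such that $\eta\{x:|x|>t\}\le c_kt^{-k}$ for all $t>0$. Let $\mathbf y=(y_{i_0,\dots,i_{n-1}})$, indexed by all nonempty finite words over $\{1,\dots,m\}$, be a family of independent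 random vectors with law $\eta$, and let $\mathbb P$ (the infinite product of copies of $\eta$) be the law of $\mathbf y$. For an infinite word $\mathbf i=(i_0,i_1,\dots)$ put $$\Pi^{\mathbf y}(\mathbf i)=\lim_{r\to\infty}(f_{i_0}+y_{i_0})\circ(f_{i_1}+y_{i_0,i_1})\circ\dots\circ(f_{i_r}+y_{i_0,\dots,i_r})(0)$$ whenever the limit exists, and, if it exists for all $\mathbf i$, let $\Lambda^{\mathbf y}=\{\Pi^{\mathbf y}(\mathbf i):\mathbf i\in\{1,\dots,m\}^{\mathbb N}\}$. Then: (0) for $\mathbb P$-almost every $\mathbf y$ the limit $\Pi^{\mathbf y}(\mathbf i)$ exists for all infinite words $\mathbf i$, so that $\Lambda^{\mathbf y}$ is well defined; (1) if $d(T_1,\dots,T_m)\le d$, then $\dim_H\Lambda^{\mathbf y}=d(T_1,\dots,T_m)$ for $\mathbb P$-almost every $\mathbf y$; (2) if $d(T_1,\dots,T_m)>d$, then $\Lambda^{\mathbf y}$ has positive $d$-dimensional Lebesgue measure for $\mathbb P$-almost every $\mathbf y$. -/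

import Mathlib

open MeasureTheory Filter Topology
open scoped ENNReal NNReal

namespace RandomSelfAffine

/-- `ℝ^d` with the Euclidean norm. -/
abbrev Space (d : ℕ) : Type := EuclideanSpace ℝ (Fin d)

/-- Nonempty finite words `(i_0, …, i_n)` over an alphabet of `m` letters; the word
`⟨n, w⟩` has length `n + 1`. -/
abbrev Word (m : ℕ) : Type := Σ n : ℕ, Fin (n + 1) → Fin m

/-- The initial segment `(i_0, …, i_n)` of an infinite word. -/
def restrict {m : ℕ} (i : ℕ → Fin m) (n : ℕ) : Word m := ⟨n, fun k => i k⟩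

/-- The product `T_{i_0} T_{i_1} ⋯ T_{i_{n-1}}` along a word of length `n`. -/
noncomputable def wordProd {d m : ℕ} (T : Fin m → Space d →L[ℝ] Space d) {n : ℕ}
    (w : Fin n → Fin m) : Space d →L[ℝ] Space d :=
  (List.ofFn fun k => T (w k)).prod

/-- The singular value function `φ^s`. The singular values `α_1 ≥ α_2 ≥ …` are indexed from
zero by `LinearMap.singularValues`, so that `α_k = α (k - 1)`. With `r = ⌈s⌉`,
`φ^s = α_1 ⋯ α_{r-1} α_r ^ (s - r + 1)` for `0 < s ≤ d` and `φ^s = (α_1 ⋯ α_d) ^ (s / d)` for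
`s > d`; by convention `φ^s = 1` for `s ≤ 0`. -/
noncomputable def singularValueFunction {d : ℕ} (s : ℝ) (A : Space d →L[ℝ] Space d) : ℝ :=
  let α : ℕ → ℝ := fun k => (A : Space d →ₗ[ℝ] Space d).singularValues k
  if s ≤ 0 then 1
  else if s ≤ d then
    (∏ k ∈ Finset.range (⌈s⌉₊ - 1), α k) * α (⌈s⌉₊ - 1) ^ (s - (⌈s⌉₊ : ℝ) + 1)
  else (∏ k ∈ Finset.range d, α k) ^ (s / (d : ℝ))

/-- The affinity dimension
`d(T_1, …, T_m) = inf {s > 0 : ∑_n ∑_{|w| = n} φ^s(T_w) < ∞}`, as an element of `[0, ∞]`. -/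
noncomputable def affinityDim {d m : ℕ} (T : Fin m → Space d →L[ℝ] Space d) : ℝ≥0∞ :=
  ⨅ s ∈ {s : ℝ | 0 < s ∧
      Summable fun n : ℕ => ∑ w : Fin n → Fin m, singularValueFunction s (wordProd T w)},
    ENNReal.ofReal s

/-- The perturbed map `f_{i_n} + y_{i_0, …, i_n}` attached to the word `(i_0, …, i_n)`, where
`f_i x = T_i x + a_i`. -/
noncomputable def perturbedMap {d m : ℕ} (T : Fin m → Space d →L[ℝ] Space d)
    (a : Fin m → Space d) (y : Word m → Space d) (w : Word m) (x : Space d) : Space d :=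
  T (w.2 (Fin.last w.1)) x + a (w.2 (Fin.last w.1)) + y w

/-- The composition of the first `n` perturbed maps along `i`, that is
`(f_{i_0} + y_{i_0}) ∘ (f_{i_1} + y_{i_0, i_1}) ∘ ⋯ ∘ (f_{i_{n-1}} + y_{i_0, …, i_{n-1}})`. -/
noncomputable def perturbedComp {d m : ℕ} (T : Fin m → Space d →L[ℝ] Space d)
    (a : Fin m → Space d) (y : Word m → Space d) (i : ℕ → Fin m) : ℕ → Space d → Space d
  | 0 => id
  | n + 1 => perturbedComp T a y i n ∘ perturbedMap T a y (restrict i n)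

/-- The limit of the perturbed compositions applied to the origin exists along every
infinite word. -/
def IsWellDefined {d m : ℕ} (T : Fin m → Space d →L[ℝ] Space d)
    (a : Fin m → Space d) (y : Word m → Space d) : Prop :=
  ∀ i : ℕ → Fin m, ∃ x : Space d, Tendsto (fun r => perturbedComp T a y i (r + 1) 0) atTop (𝓝 x)

/-- The coding map `Π^y(i)`: the limit of the perturbed compositions applied to the origin
(meaningful where that limit exists). -/
noncomputable def codingMap {d m : ℕ} (T : Fin m → Space d →L[ℝ] Space d)
    (a : Fin m → Space d) (y : Word m → Space d) (i : ℕ → Fin m) : Space d :=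
  limUnder atTop fun r => perturbedComp T a y i (r + 1) 0

/-- The random attractor `Λ^y = {Π^y(i) : i an infinite word}`. -/
noncomputable def attractor {d m : ℕ} (T : Fin m → Space d →L[ℝ] Space d)
    (a : Fin m → Space d) (y : Word m → Space d) : Set (Space d) :=
  Set.range (codingMap T a y)

/-- `η` is absolutely continuous with a bounded density with respect to Lebesgue measure. -/
def HasBoundedDensity {d : ℕ} (η : Measure (Space d)) : Prop :=
  ∃ f : Space d → ℝ≥0∞, Measurable f ∧ (∃ K : ℝ≥0, ∀ x, f x ≤ K) ∧ η = volume.withDensity f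

/-- The tails of `η` decay faster than every power. -/
def HasSuperpolynomialDecay {d : ℕ} (η : Measure (Space d)) : Prop :=
  ∀ k : ℕ, ∃ c : ℝ, ∀ t : ℝ, 0 < t → η.real {x | t < ‖x‖} ≤ c / t ^ k

/-- The law of an independent family of perturbations, one for each nonempty finite word, all
distributed according to `η`. -/
noncomputable def perturbationLaw {d : ℕ} (m : ℕ) (η : Measure (Space d))
    [IsProbabilityMeasure η] : Measure (Word m → Space d) :=
  Measure.infinitePi fun _ => η

end RandomSelfAffine

/-!
Write `φ^s` for the singular value function, `T_w` for the product of the `T_i` along a finite word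
`w`, `[w]` for the set of infinite words that begin with `w`, and `Π` for the coding map.

All information about `φ^s` comes from the volume of `slab A R r = {‖x‖ ≤ R, ‖A x‖ ≤ r}`. In the
orthonormal basis that diagonalizes `x ↦ ‖A x‖ ^ 2` this is squeezed between boxes, so for
`0 < s ≤ d` the volume is at most of order `R ^ (d - s) r ^ s / φ^s(A)`, with equality up to a
constant when `R = 1` and `r` is the singular value of index `⌈s⌉` (`volume_slab_le`,
`le_volume_slab`). Fubini's theorem then makes `φ^s` submultiplicative up to a constant, and a
packing argument covers the image of the unit ball efficiently by balls of that radius.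

*Existence and upper bound.* By the Borel–Cantelli lemma the perturbations grow at most like
`τ ^ n` with word length `n`, for every `τ > 1` (`ae_exists_growthBound`). So the series defining `Π`
converges geometrically, and `Π [w]` lies in an affine copy of `T_w` applied to a ball of radius
`O(τ ^ n)`. The efficient covers give the bound for the Hausdorff dimension, `τ` being absorbed
by an arbitrarily small increase of the exponent.

*Lower bounds.* If `∑ φ^t(T_w)` diverges for some `t > s'`, then Frostman's lemma on the tree of
words gives a probability measure `μ` on infinite words with `μ [w] ≤ C φ^{s'}(T_w)`
(`exists_frostman_measure`). Two words `i`, `j` with longest common prefix `w` satisfy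
`Π(i) - Π(j) = T_w (y_v) + c`, where `v` is the word `w` followed by one letter of `i` and `c` does
not depend on `y_v`. Resampling `y_v` alone, the density and the decay of `η` bound the probability
that this difference has norm at most `r` by a multiple of `r ^ q / φ^s(T_w)`, where `q < s ≤ d` or
`q = s = d` (`exists_measure_norm_le`). Summing over `w` with weights `μ [w] ^ 2`, the expected
`μ × μ`-mass of the pairs coded within distance `r` is `O(r ^ q)`
(`exists_lintegral_pairMass_le`). For `q < s` this makes the energies of the image of `μ` finite,
which bounds the Hausdorff dimension from below. For `q = d`, Fatou's lemma and the Cauchy–Schwarz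
inequality bound the volumes of a sequence of neighbourhoods of the compact attractor from below,
hence also the volume of the attractor.
-/

namespace RandomSelfAffine

/-! ### Singular values and the singular value function -/

/-- The `k`-th singular value of `A`, counted from zero. -/
noncomputable abbrev singVal {d : ℕ} (A : Space d →L[ℝ] Space d) (k : ℕ) : ℝ :=
  (A : Space d →ₗ[ℝ] Space d).singularValues k

theorem singVal_nonneg {d : ℕ} (A : Space d →L[ℝ] Space d) (k : ℕ) : 0 ≤ singVal A k :=
  LinearMap.singularValues_nonneg _ k

theorem singVal_antitone {d : ℕ} (A : Space d →L[ℝ] Space d) : Antitone (singVal A) :=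
  LinearMap.singularValues_antitone _

theorem singVal_pos {d : ℕ} {A : Space d →L[ℝ] Space d} (hA : IsUnit A) {k : ℕ} (hk : k < d) :
    0 < singVal A k := by
  have hinj : Function.Injective (A : Space d →ₗ[ℝ] Space d) := by
    obtain ⟨u, rfl⟩ := hA
    intro x y hxy
    have h : ∀ z, (↑u⁻¹ : Space d →L[ℝ] Space d) ((u : Space d →L[ℝ] Space d) z) = z := by
      intro z
      rw [← mul_apply_eq_comp, u.inv_mul]
      rfl
    rw [← h x, ← h y]
    exact congrArg _ hxy
  refine (LinearMap.injective_iff_forall_lt_finrank_singularValues_pos _).1 hinj k ?_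
  simpa using hk

/-- The singular value decomposition, in the form of the quadratic form `x ↦ ‖A x‖ ^ 2` being
diagonal in an orthonormal basis. -/
theorem exists_orthonormalBasis_norm_sq {d : ℕ} (A : Space d →L[ℝ] Space d) :
    ∃ b : OrthonormalBasis (Fin d) ℝ (Space d),
      ∀ x, ‖A x‖ ^ 2 = ∑ k : Fin d, singVal A k ^ 2 * b.repr x k ^ 2 := by
  set L : Space d →ₗ[ℝ] Space d := (A : Space d →ₗ[ℝ] Space d) with hL
  have hsym := L.isSymmetric_adjoint_comp_self
  have hn : Module.finrank ℝ (Space d) = d := by simp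
  refine ⟨hsym.eigenvectorBasis hn, fun x => ?_⟩
  have h1 : ‖A x‖ ^ 2 = inner ℝ ((LinearMap.adjoint L ∘ₗ L) x) x := by
    rw [LinearMap.comp_apply, LinearMap.adjoint_inner_left, real_inner_self_eq_norm_sq]
    rfl
  rw [h1, ← (hsym.eigenvectorBasis hn).repr.inner_map_map, PiLp.inner_apply]
  refine Finset.sum_congr rfl fun k _ => ?_
  rw [hsym.eigenvectorBasis_apply_self_apply hn x k, ← L.sq_singularValues_fin hn k]
  simp only [RCLike.inner_apply, conj_trivial, RCLike.ofReal_real_eq_id, id]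
  ring

theorem singVal_le_norm {d : ℕ} (A : Space d →L[ℝ] Space d) {k : ℕ} (hk : k < d) :
    singVal A k ≤ ‖A‖ := by
  obtain ⟨b, hb⟩ := exists_orthonormalBasis_norm_sq A
  have h := hb (b ⟨k, hk⟩)
  rw [Finset.sum_eq_single ⟨k, hk⟩] at h
  · simp only [OrthonormalBasis.repr_self, PiLp.single_apply, if_true, one_pow,
      mul_one] at h
    have h2 : singVal A k = ‖A (b ⟨k, hk⟩)‖ :=
      ((sq_eq_sq₀ (norm_nonneg _) (singVal_nonneg A k)).1 h).symm
    rw [h2]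
    simpa using A.le_opNorm (b ⟨k, hk⟩)
  · intro j _ hj
    simp [hj]
  · simp

/-- The exponent of the `k`-th singular value in `φ^s`, so that
`φ^s(A) = ∏_{k < d} α_k ^ (svExp d s k)`. -/
noncomputable def svExp (d : ℕ) (s : ℝ) (k : ℕ) : ℝ :=
  if s ≤ d then max 0 (min 1 (s - k)) else s / d

theorem svExp_of_le {d : ℕ} {s : ℝ} (hs : s ≤ d) (k : ℕ) :
    svExp d s k = max 0 (min 1 (s - k)) := if_pos hs

theorem svExp_of_lt {d : ℕ} {s : ℝ} (hs : (d : ℝ) < s) (k : ℕ) :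
    svExp d s k = s / d := if_neg hs.not_ge

theorem svExp_nonneg (d : ℕ) (s : ℝ) (k : ℕ) : 0 ≤ svExp d s k := by
  unfold svExp
  split_ifs with h
  · exact le_max_left _ _
  · have : (0 : ℝ) ≤ d := d.cast_nonneg
    exact div_nonneg (this.trans (not_le.1 h).le) this

theorem svExp_le_one {d : ℕ} {s : ℝ} (hs : s ≤ d) (k : ℕ) : svExp d s k ≤ 1 := by
  rw [svExp_of_le hs]
  exact max_le zero_le_one (min_le_left _ _)

theorem svExp_self {d k : ℕ} (hk : k < d) : svExp d d k = 1 := by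
  rw [svExp_of_le le_rfl]
  have : (k : ℝ) + 1 ≤ d := by exact_mod_cast hk
  rw [min_eq_left (by linarith), max_eq_right zero_le_one]

theorem svExp_mono {d : ℕ} (hd : 1 ≤ d) {s t : ℝ} (hst : s ≤ t) (k : ℕ) :
    svExp d s k ≤ svExp d t k := by
  have hd' : (0 : ℝ) < d := by exact_mod_cast hd
  unfold svExp
  split_ifs with h1 h2 h2
  · gcongr
  · refine (max_le zero_le_one (min_le_left _ _)).trans ?_
    rw [one_le_div hd']
    exact (not_le.1 h2).le
  · exact absurd (hst.trans h2) h1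
  · gcongr

theorem svExp_of_ceil {d : ℕ} {s : ℝ} (hs0 : 0 < s) (hs : s ≤ d) (k : ℕ) :
    svExp d s k =
      if k < ⌈s⌉₊ - 1 then 1 else if k = ⌈s⌉₊ - 1 then s - (⌈s⌉₊ : ℝ) + 1 else 0 := by
  rw [svExp_of_le hs]
  obtain ⟨r, hr⟩ : ∃ r, ⌈s⌉₊ = r + 1 := ⟨⌈s⌉₊ - 1, by have := Nat.ceil_pos.2 hs0; omega⟩
  have h1 : s ≤ r + 1 := by have := Nat.le_ceil s; rw [hr] at this; exact_mod_cast this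
  have h2 : (r : ℝ) < s := Nat.lt_ceil.1 (by omega)
  rw [hr]
  simp only [Nat.add_sub_cancel, Nat.cast_add, Nat.cast_one]
  split_ifs with h3 h4
  · have : (k : ℝ) + 1 ≤ r := by exact_mod_cast h3
    rw [min_eq_left (by linarith), max_eq_right zero_le_one]
  · subst h4
    rw [min_eq_right (by linarith), max_eq_right (by linarith)]
    ring
  · have : (r : ℝ) + 1 ≤ k := by exact_mod_cast (by omega : r + 1 ≤ k)
    rw [max_eq_left ((min_le_right _ _).trans (by linarith))]

theorem sum_svExp {d : ℕ} (hd : 1 ≤ d) {s : ℝ} (hs0 : 0 < s) :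
    ∑ k : Fin d, svExp d s k = s := by
  have hd' : (0 : ℝ) < d := by exact_mod_cast hd
  rcases le_or_gt s d with hs | hs
  · obtain ⟨r, hr⟩ : ∃ r, ⌈s⌉₊ = r + 1 := ⟨⌈s⌉₊ - 1, by have := Nat.ceil_pos.2 hs0; omega⟩
    have hrd : r + 1 ≤ d := by rw [← hr]; exact Nat.ceil_le.2 hs
    rw [Fin.sum_univ_eq_sum_range (svExp d s) d,
      ← Finset.sum_range_add_sum_Ico _ hrd, Finset.sum_range_succ]
    have e1 : ∑ k ∈ Finset.range r, svExp d s k = r := by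
      rw [Finset.sum_congr rfl (g := fun _ => (1 : ℝ))]
      · simp
      · intro k hk
        rw [svExp_of_ceil hs0 hs, hr, if_pos (by simpa using hk)]
    have e2 : ∑ k ∈ Finset.Ico (r + 1) d, svExp d s k = 0 := by
      refine Finset.sum_eq_zero fun k hk => ?_
      rw [Finset.mem_Ico] at hk
      rw [svExp_of_ceil hs0 hs, hr, if_neg (by omega), if_neg (by omega)]
    rw [e1, e2, svExp_of_ceil hs0 hs, hr]
    simp
    ring
  · simp only [svExp_of_lt hs, Finset.sum_const, Finset.card_univ, Fintype.card_fin, nsmul_eq_mul]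
    field_simp

theorem singularValueFunction_eq_prod {d : ℕ} {s : ℝ} (hs0 : 0 < s)
    (A : Space d →L[ℝ] Space d) :
    singularValueFunction s A = ∏ k : Fin d, singVal A k ^ svExp d s k := by
  unfold singularValueFunction
  simp only [if_neg hs0.not_ge]
  rw [Fin.prod_univ_eq_prod_range (fun k => singVal A k ^ svExp d s k) d]
  split_ifs with hs
  · obtain ⟨r, hr⟩ : ∃ r, ⌈s⌉₊ = r + 1 := ⟨⌈s⌉₊ - 1, by have := Nat.ceil_pos.2 hs0; omega⟩
    have hrd : r + 1 ≤ d := by rw [← hr]; exact Nat.ceil_le.2 hs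
    rw [← Finset.prod_range_mul_prod_Ico _ hrd, Finset.prod_range_succ]
    have e1 : ∏ k ∈ Finset.range r, singVal A k ^ svExp d s k
        = ∏ k ∈ Finset.range r, singVal A k := by
      refine Finset.prod_congr rfl fun k hk => ?_
      rw [svExp_of_ceil hs0 hs, hr, if_pos (by simpa using hk), Real.rpow_one]
    have e2 : ∏ k ∈ Finset.Ico (r + 1) d, singVal A k ^ svExp d s k = 1 := by
      refine Finset.prod_eq_one fun k hk => ?_
      rw [Finset.mem_Ico] at hk
      rw [svExp_of_ceil hs0 hs, hr, if_neg (by omega), if_neg (by omega), Real.rpow_zero]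
    rw [e1, e2, svExp_of_ceil hs0 hs, hr]
    simp
  · rw [← Real.finsetProd_rpow _ _ fun k _ => singVal_nonneg A k]
    exact Finset.prod_congr rfl fun k _ => by rw [svExp_of_lt (not_le.1 hs)]

theorem singularValueFunction_eq_rpow {d : ℕ} (hd : 1 ≤ d) {s : ℝ} (hs : (d : ℝ) < s)
    (A : Space d →L[ℝ] Space d) :
    singularValueFunction s A = singularValueFunction d A ^ (s / d) := by
  have hd' : (0 : ℝ) < d := by exact_mod_cast hd
  rw [singularValueFunction_eq_prod hd', singularValueFunction_eq_prod (hd'.trans hs),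
    ← Real.finsetProd_rpow _ _ fun (k : Fin d) _ => Real.rpow_nonneg (singVal_nonneg A k) _]
  refine Finset.prod_congr rfl fun k _ => ?_
  rw [svExp_of_lt hs, svExp_self k.2, Real.rpow_one]

theorem singularValueFunction_nonneg {d : ℕ} {s : ℝ} (hs0 : 0 < s)
    (A : Space d →L[ℝ] Space d) : 0 ≤ singularValueFunction s A := by
  rw [singularValueFunction_eq_prod hs0]
  exact Finset.prod_nonneg fun k _ => Real.rpow_nonneg (singVal_nonneg A k) _

theorem singularValueFunction_pos {d : ℕ} {s : ℝ} (hs0 : 0 < s)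
    {A : Space d →L[ℝ] Space d} (hA : IsUnit A) : 0 < singularValueFunction s A := by
  rw [singularValueFunction_eq_prod hs0]
  exact Finset.prod_pos fun k _ => Real.rpow_pos_of_pos (singVal_pos hA k.2) _

theorem singularValueFunction_le_one {d : ℕ} {s : ℝ} (hs0 : 0 < s)
    {A : Space d →L[ℝ] Space d} (hA : ‖A‖ ≤ 1) : singularValueFunction s A ≤ 1 := by
  rw [singularValueFunction_eq_prod hs0]
  refine Finset.prod_le_one (fun k _ => Real.rpow_nonneg (singVal_nonneg A k) _) fun k _ => ?_
  exact Real.rpow_le_one (singVal_nonneg A k) ((singVal_le_norm A k.2).trans hA)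
    (svExp_nonneg _ _ _)

/-- Raising the exponent from `s` to `t` multiplies `φ` by at most `‖A‖ ^ (t - s)`, also when the
exponents lie on different sides of `d`. -/
theorem singularValueFunction_le_mul {d : ℕ} (hd : 1 ≤ d) {s t c : ℝ} (hs0 : 0 < s) (hst : s ≤ t)
    {A : Space d →L[ℝ] Space d} (hA : IsUnit A) (hc : ‖A‖ ≤ c) :
    singularValueFunction t A ≤ c ^ (t - s) * singularValueFunction s A := by
  rw [singularValueFunction_eq_prod hs0, singularValueFunction_eq_prod (hs0.trans_le hst)]
  have hc0 : 0 ≤ c := (norm_nonneg _).trans hc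
  have e : c ^ (t - s) = ∏ k : Fin d, c ^ (svExp d t k - svExp d s k) := by
    rw [← Real.rpow_sum_of_nonneg hc0 (s := Finset.univ)
      (f := fun k : Fin d => svExp d t k - svExp d s k)
      fun k _ => sub_nonneg.2 (svExp_mono hd hst k),
      Finset.sum_sub_distrib, sum_svExp hd hs0, sum_svExp hd (hs0.trans_le hst)]
  rw [e, ← Finset.prod_mul_distrib]
  refine Finset.prod_le_prod (fun k _ => Real.rpow_nonneg (singVal_nonneg A k) _) fun k _ => ?_
  have hp := singVal_pos hA k.2
  calc singVal A k ^ svExp d t k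
      = singVal A k ^ (svExp d t k - svExp d s k) * singVal A k ^ svExp d s k := by
        rw [← Real.rpow_add hp, sub_add_cancel]
    _ ≤ _ := by
        gcongr
        · exact sub_nonneg.2 (svExp_mono hd hst k)
        · exact (singVal_le_norm A k.2).trans hc

/-! ### Volumes and covers of ellipsoids -/

/-- The volume of a box with sides along an orthonormal basis. -/
theorem volume_box {d : ℕ} (b : OrthonormalBasis (Fin d) ℝ (Space d)) (c : Fin d → ℝ) :
    volume {x | ∀ k, |b.repr x k| ≤ c k} = ∏ k, ENNReal.ofReal (2 * c k) := by
  have h1 : {x | ∀ k, |b.repr x k| ≤ c k}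
      = b.repr ⁻¹' ((MeasurableEquiv.toLp 2 (Fin d → ℝ)).symm ⁻¹'
        (Set.univ.pi fun k => Set.Icc (-c k) (c k))) := by
    ext x
    simp only [Set.mem_ofPred_eq, abs_le, Set.mem_preimage, Set.mem_pi, Set.mem_univ, Set.mem_Icc,
      forall_true_left]
    rfl
  have hm : MeasurableSet (Set.univ.pi fun k => Set.Icc (-c k) (c k)) :=
    MeasurableSet.univ_pi fun _ => measurableSet_Icc
  rw [h1, b.measurePreserving_repr.measure_preimage
      ((MeasurableEquiv.measurable _ hm).nullMeasurableSet),
    (EuclideanSpace.volume_preserving_symm_measurableEquiv_toLp (Fin d)).measure_preimage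
      hm.nullMeasurableSet, volume_pi_pi]
  refine Finset.prod_congr rfl fun k _ => ?_
  rw [Real.volume_Icc]
  ring_nf

/-- The part of the ball of radius `R` that `A` maps into the ball of radius `r`. Its volume is
comparable to `∏_k min(R, r / α_k)`, and is the quantity through which the singular value function
enters all estimates. -/
def slab {d : ℕ} (A : Space d →L[ℝ] Space d) (R r : ℝ) : Set (Space d) :=
  {x | ‖x‖ ≤ R ∧ ‖A x‖ ≤ r}

theorem isClosed_slab {d : ℕ} (A : Space d →L[ℝ] Space d) (R r : ℝ) : IsClosed (slab A R r) :=
  (isClosed_le continuous_norm continuous_const).inter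
    (isClosed_le A.continuous.norm continuous_const)

theorem volume_slab_le {d : ℕ} (hd : 1 ≤ d) {s R r : ℝ} (hs0 : 0 < s) (hs : s ≤ d)
    (hR : 0 < R) (hr : 0 < r) {A : Space d →L[ℝ] Space d} (hA : IsUnit A) :
    volume (slab A R r) ≤
      ENNReal.ofReal (2 ^ d * (R ^ (d - s) * r ^ s / singularValueFunction s A)) := by
  obtain ⟨b, hb⟩ := exists_orthonormalBasis_norm_sq A
  set e : Fin d → ℝ := fun k => svExp d s k with he
  have hsub : slab A R r ⊆
      {x | ∀ k, |b.repr x k| ≤ R ^ (1 - e k) * (r / singVal A k) ^ e k} := by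
    rintro x ⟨hx1, hx2⟩ k
    have hα := singVal_pos hA k.2
    have h1 : |b.repr x k| ≤ R := by
      refine le_trans ?_ hx1
      rw [← b.repr.norm_map x]
      exact PiLp.norm_apply_le (b.repr x) k
    have h2 : |b.repr x k| ≤ r / singVal A k := by
      rw [le_div_iff₀ hα]
      refine le_trans ?_ hx2
      rw [mul_comm]
      refine abs_le_of_sq_le_sq' ?_ (norm_nonneg _) |>.2
      rw [hb x, mul_pow, sq_abs]
      exact Finset.single_le_sum (f := fun k : Fin d => singVal A k ^ 2 * b.repr x k ^ 2)
        (fun _ _ => by positivity) (Finset.mem_univ k)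
    calc |b.repr x k| = |b.repr x k| ^ (1 - e k) * |b.repr x k| ^ e k := by
          rw [← Real.rpow_add' (abs_nonneg _) (by norm_num)]
          norm_num
      _ ≤ _ := by
          gcongr
          · exact sub_nonneg.2 (svExp_le_one hs _)
          · exact svExp_nonneg _ _ _
  refine (measure_mono hsub).trans ?_
  rw [volume_box, ← ENNReal.ofReal_prod_of_nonneg]
  · refine ENNReal.ofReal_le_ofReal (le_of_eq ?_)
    rw [Finset.prod_mul_distrib, Finset.prod_mul_distrib, Finset.prod_const, Finset.card_univ,
      Fintype.card_fin]
    rw [mul_div_assoc]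
    congr 2
    · rw [← Real.rpow_sum_of_nonneg hR.le (s := Finset.univ) (f := fun k => 1 - e k)
        fun k _ => sub_nonneg.2 (svExp_le_one hs _), Finset.sum_sub_distrib, sum_svExp hd hs0]
      simp
    · rw [singularValueFunction_eq_prod hs0, Finset.prod_congr rfl fun k _ =>
        Real.div_rpow hr.le (singVal_nonneg A _) (e k), Finset.prod_div_distrib,
        ← Real.rpow_sum_of_nonneg hr.le (s := Finset.univ) (f := e)
        fun k _ => svExp_nonneg _ _ _, sum_svExp hd hs0]
  · intro k _
    have hα := singVal_pos hA k.2
    positivity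

/-- The singular value of index `⌈s⌉`, counted from one: the scale at which `φ^s` is attained. -/
noncomputable def critSV {d : ℕ} (s : ℝ) (A : Space d →L[ℝ] Space d) : ℝ :=
  singVal A (⌈s⌉₊ - 1)

theorem ceil_sub_one_lt {d : ℕ} {s : ℝ} (hs0 : 0 < s) (hs : s ≤ d) : ⌈s⌉₊ - 1 < d := by
  have h1 := Nat.ceil_pos.2 hs0
  have h2 : ⌈s⌉₊ ≤ d := Nat.ceil_le.2 hs
  omega

theorem critSV_pos {d : ℕ} {s : ℝ} (hs0 : 0 < s) (hs : s ≤ d) {A : Space d →L[ℝ] Space d}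
    (hA : IsUnit A) : 0 < critSV s A := singVal_pos hA (ceil_sub_one_lt hs0 hs)

/-- At the critical scale the upper bound of `volume_slab_le` is attained up to a constant. -/
theorem le_volume_slab {d : ℕ} (hd : 1 ≤ d) {s : ℝ} (hs0 : 0 < s) (hs : s ≤ d)
    {A : Space d →L[ℝ] Space d} (hA : IsUnit A) :
    ENNReal.ofReal ((2 / √d) ^ d * (critSV s A ^ s / singularValueFunction s A)) ≤
      volume (slab A 1 (critSV s A)) := by
  obtain ⟨b, hb⟩ := exists_orthonormalBasis_norm_sq A
  have hd' : (0 : ℝ) < d := by exact_mod_cast hd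
  have hdsq : 0 < √(d : ℝ) := Real.sqrt_pos.2 hd'
  set e : Fin d → ℝ := fun k => svExp d s k with he
  set r := critSV s A with hr
  have hr0 : 0 < r := critSV_pos hs0 hs hA
  have key : ∀ k : Fin d, (r / singVal A k) ^ e k ≤ 1 ∧
      singVal A k * (r / singVal A k) ^ e k ≤ r := by
    intro k
    have hα := singVal_pos hA k.2
    simp only [he]
    rw [svExp_of_ceil hs0 hs]
    split_ifs with h1 h2
    · rw [Real.rpow_one]
      refine ⟨(div_le_one hα).2 (singVal_antitone A h1.le), ?_⟩
      rw [mul_div_cancel₀ _ hα.ne']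
    · have : singVal A k = r := by rw [hr, critSV, h2]
      rw [this, div_self hr0.ne', Real.one_rpow]
      simp
    · rw [Real.rpow_zero]
      refine ⟨le_rfl, ?_⟩
      rw [mul_one]
      exact singVal_antitone A (by omega)
  have hsub : {x | ∀ k, |b.repr x k| ≤ (r / singVal A k) ^ e k / √d} ⊆ slab A 1 r := by
    intro x hx
    have hx' : ∀ k, b.repr x k ^ 2 ≤ ((r / singVal A k) ^ e k) ^ 2 / d := by
      intro k
      rw [← sq_abs, ← Real.sq_sqrt hd'.le, ← div_pow]
      have := hx k
      gcongr
    constructor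
    · refine (abs_le_of_sq_le_sq' ?_ zero_le_one).2
      rw [← b.repr.norm_map x, EuclideanSpace.norm_sq_eq]
      calc ∑ k, ‖b.repr x k‖ ^ 2 ≤ ∑ k : Fin d, (1 : ℝ) / d := by
            refine Finset.sum_le_sum fun k _ => ?_
            rw [Real.norm_eq_abs, sq_abs]
            refine (hx' k).trans ?_
            have hα := singVal_pos hA k.2
            gcongr
            exact pow_le_one₀ (by positivity) (key k).1
        _ = 1 ^ 2 := by simp [hd'.ne']
    · refine (abs_le_of_sq_le_sq' ?_ hr0.le).2
      rw [hb x]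
      calc ∑ k : Fin d, singVal A k ^ 2 * b.repr x k ^ 2 ≤ ∑ k : Fin d, r ^ 2 / d := by
            refine Finset.sum_le_sum fun k _ => ?_
            have hα := singVal_pos hA k.2
            calc singVal A k ^ 2 * b.repr x k ^ 2
                ≤ singVal A k ^ 2 * (((r / singVal A k) ^ e k) ^ 2 / d) := by
                  gcongr; exact hx' k
              _ = (singVal A k * (r / singVal A k) ^ e k) ^ 2 / d := by ring
              _ ≤ r ^ 2 / d := by
                  gcongr
                  exact (key k).2
        _ = r ^ 2 := by simp; field_simp
  refine le_trans (le_of_eq ?_) (measure_mono hsub)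
  rw [volume_box, ← ENNReal.ofReal_prod_of_nonneg]
  · congr 1
    rw [singularValueFunction_eq_prod hs0]
    have : ∀ k : Fin d, 2 * ((r / singVal A k) ^ e k / √d)
        = 2 / √d * (r ^ e k / singVal A k ^ e k) := by
      intro k
      rw [Real.div_rpow hr0.le (singVal_nonneg A k)]
      ring
    rw [Finset.prod_congr rfl fun k _ => this k, Finset.prod_mul_distrib, Finset.prod_const,
      Finset.card_univ, Fintype.card_fin, Finset.prod_div_distrib,
      ← Real.rpow_sum_of_nonneg hr0.le (s := Finset.univ) (f := e)
        fun k _ => svExp_nonneg _ _ _, sum_svExp hd hs0]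
  · intro k _
    have hα := singVal_pos hA k.2
    positivity

/-- Slabs of a product contain, up to translation, a fibre of the sheared product of the slabs of
the factors; Fubini's theorem finds a fibre of at least average size. -/
theorem volume_slab_mul_le {d : ℕ} (A B : Space d →L[ℝ] Space d) {r ρ : ℝ} (hr : 0 < r) :
    volume (slab B 1 r) * volume (slab A 1 ρ) ≤
      volume (slab (A * B) 2 (2 * (r * ρ))) * volume (Metric.closedBall (0 : Space d) 2) := by
  set SB := slab B 1 r
  set SA := slab A 1 ρ
  set f : Space d → Space d → ℝ≥0∞ := fun x z =>
    SB.indicator 1 x * SA.indicator 1 (z - r⁻¹ • B x)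
  have hmB : MeasurableSet SB := (isClosed_slab B 1 r).measurableSet
  have hmA : MeasurableSet SA := (isClosed_slab A 1 ρ).measurableSet
  have hind : Measurable (SA.indicator (1 : Space d → ℝ≥0∞)) := measurable_one.indicator hmA
  have hindB : Measurable (SB.indicator (1 : Space d → ℝ≥0∞)) := measurable_one.indicator hmB
  have hmf : Measurable (Function.uncurry f) := by
    refine (hindB.comp measurable_fst).mul (hind.comp ?_)
    have : Continuous fun p : Space d × Space d => p.2 - r⁻¹ • B p.1 := by fun_prop
    exact this.measurable
  have h1 : ∫⁻ x, ∫⁻ z, f x z = volume SB * volume SA := by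
    have : ∀ x, ∫⁻ z, f x z = SB.indicator 1 x * volume SA := by
      intro x
      have hm : Measurable fun z => SA.indicator (1 : Space d → ℝ≥0∞) (z - r⁻¹ • B x) :=
        hind.comp (measurable_id.sub_const _)
      simp only [f]
      rw [lintegral_const_mul _ hm,
        lintegral_sub_right_eq_self (fun z => SA.indicator (1 : Space d → ℝ≥0∞) z),
        lintegral_indicator_one hmA]
    simp_rw [this]
    rw [lintegral_mul_const _ hindB, lintegral_indicator_one hmB]
  rw [← h1, lintegral_lintegral_swap hmf.aemeasurable, ← setLIntegral_const,
    ← lintegral_indicator Metric.isClosed_closedBall.measurableSet]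
  refine lintegral_mono fun z => ?_
  by_cases hne : ∃ x₀, x₀ ∈ SB ∧ z - r⁻¹ • B x₀ ∈ SA
  · obtain ⟨x₀, ⟨hx1, hx2⟩, hx3, hx4⟩ := hne
    have hz : z ∈ Metric.closedBall (0 : Space d) 2 := by
      rw [mem_closedBall_zero_iff]
      calc ‖z‖ = ‖(z - r⁻¹ • B x₀) + r⁻¹ • B x₀‖ := by rw [sub_add_cancel]
        _ ≤ 1 + 1 := by
          refine (norm_add_le _ _).trans (add_le_add hx3 ?_)
          rw [norm_smul, norm_inv, Real.norm_of_nonneg hr.le, inv_mul_le_iff₀ hr, mul_one]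
          exact hx2
        _ = 2 := by norm_num
    rw [Set.indicator_of_mem hz]
    have hle : ∀ x, f x z ≤ (slab (A * B) 2 (2 * (r * ρ))).indicator 1 (x - x₀) := by
      intro x
      by_cases hx : x ∈ SB ∧ z - r⁻¹ • B x ∈ SA
      · obtain ⟨⟨h1, h2⟩, h3, h4⟩ := hx
        rw [Set.indicator_of_mem]
        · exact (mul_le_mul' (Set.indicator_apply_le' (fun _ => le_rfl) fun _ => zero_le)
            (Set.indicator_apply_le' (fun _ => le_rfl) fun _ => zero_le)).trans (one_mul 1).le
        · refine ⟨(norm_sub_le _ _).trans (by linarith), ?_⟩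
          have e : (A * B) (x - x₀) = r • (A (z - r⁻¹ • B x₀) - A (z - r⁻¹ • B x)) := by
            rw [mul_apply_eq_comp, ← map_sub, ← map_smul]
            congr 1
            rw [sub_sub_sub_cancel_left, ← smul_sub, smul_inv_smul₀ hr.ne', map_sub]
          rw [e, norm_smul, Real.norm_of_nonneg hr.le]
          calc r * ‖A (z - r⁻¹ • B x₀) - A (z - r⁻¹ • B x)‖ ≤ r * (ρ + ρ) := by
                gcongr
                exact (norm_sub_le _ _).trans (add_le_add hx4 h4)
            _ = _ := by ring
      · have : f x z = 0 := by
          rw [not_and_or] at hx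
          rcases hx with hx | hx
          · simp [f, Set.indicator_of_notMem hx]
          · simp [f, Set.indicator_of_notMem hx]
        rw [this]
        exact zero_le
    refine (lintegral_mono hle).trans (le_of_eq ?_)
    rw [lintegral_sub_right_eq_self
      (fun x => (slab (A * B) 2 (2 * (r * ρ))).indicator (1 : Space d → ℝ≥0∞) x),
      lintegral_indicator_one (isClosed_slab _ _ _).measurableSet]
  · have : ∀ x, f x z = 0 := by
      intro x
      by_cases hx : x ∈ SB
      · have : z - r⁻¹ • B x ∉ SA := fun h => hne ⟨x, hx, h⟩
        simp [f, Set.indicator_of_notMem this]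
      · simp [f, Set.indicator_of_notMem hx]
    simp [this]

theorem exists_singularValueFunction_mul_le_of_le {d : ℕ} (hd : 1 ≤ d) {s : ℝ} (hs0 : 0 < s)
    (hs : s ≤ d) : ∃ C : ℝ, 0 < C ∧ ∀ A B : Space d →L[ℝ] Space d, IsUnit A → IsUnit B →
      singularValueFunction s (A * B) ≤
        C * (singularValueFunction s A * singularValueFunction s B) := by
  have hd' : (0 : ℝ) < d := by exact_mod_cast hd
  have hdsq : 0 < √(d : ℝ) := Real.sqrt_pos.2 hd'
  set v := volume.real (Metric.closedBall (0 : Space d) 2) with hv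
  have hvf : volume (Metric.closedBall (0 : Space d) 2) ≠ ∞ :=
    (isCompact_closedBall _ _).measure_lt_top.ne
  have hv0 : 0 < v := by
    refine ENNReal.toReal_pos ?_ hvf
    exact (Metric.measure_closedBall_pos volume _ (by norm_num)).ne'
  set c := (2 / √(d : ℝ)) ^ d
  have hc : 0 < c := by positivity
  refine ⟨2 ^ d * 2 ^ ((d : ℝ) - s) * 2 ^ s * v / c ^ 2, by positivity, fun A B hA hB => ?_⟩
  have hr := critSV_pos hs0 hs hB
  have hρ := critSV_pos hs0 hs hA
  set r := critSV s B
  set ρ := critSV s A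
  have hAB : IsUnit (A * B) := hA.mul hB
  have pA := singularValueFunction_pos hs0 hA
  have pB := singularValueFunction_pos hs0 hB
  have pAB := singularValueFunction_pos hs0 hAB
  have h := volume_slab_mul_le A B (ρ := ρ) hr
  have h2 := (mul_le_mul' (le_volume_slab hd hs0 hs hB) (le_volume_slab hd hs0 hs hA)).trans
    (h.trans (mul_le_mul_left (volume_slab_le hd hs0 hs zero_lt_two
      (by positivity : 0 < 2 * (r * ρ)) hAB) _))
  rw [← ENNReal.ofReal_toReal hvf, ← ENNReal.ofReal_mul (by positivity),
    ← ENNReal.ofReal_mul (by positivity), ENNReal.ofReal_le_ofReal_iff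
      (mul_nonneg (by positivity) ENNReal.toReal_nonneg)] at h2
  change _ ≤ _ * v at h2
  rw [Real.mul_rpow zero_le_two (by positivity), Real.mul_rpow hr.le hρ.le] at h2
  have hrs : 0 < r ^ s := by positivity
  have hρs : 0 < ρ ^ s := by positivity
  change c * (r ^ s / _) * (c * (ρ ^ s / _)) ≤ _ at h2
  set X := singularValueFunction s A
  set Y := singularValueFunction s B
  set Z := singularValueFunction s (A * B)
  rw [div_mul_eq_mul_div, le_div_iff₀ (by positivity)]
  have e1 : c * (r ^ s / Y) * (c * (ρ ^ s / X)) = c ^ 2 * (r ^ s * ρ ^ s) / (X * Y) := by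
    field_simp
  have e2 : 2 ^ d * (2 ^ ((d : ℝ) - s) * (2 ^ s * (r ^ s * ρ ^ s)) / Z) * v
    = (2 ^ d * 2 ^ ((d : ℝ) - s) * 2 ^ s * v) * (r ^ s * ρ ^ s) / Z := by ring
  rw [e1, e2, div_le_div_iff₀ (by positivity) pAB] at h2
  have h3 : (Z * c ^ 2) * (r ^ s * ρ ^ s) ≤
      (2 ^ d * 2 ^ ((d : ℝ) - s) * 2 ^ s * v * (X * Y)) * (r ^ s * ρ ^ s) := by
    linarith
  exact le_of_mul_le_mul_right h3 (by positivity)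

/-- The singular value function is submultiplicative up to a constant, which is all that the
construction of Frostman measures needs. -/
theorem exists_singularValueFunction_mul_le {d : ℕ} (hd : 1 ≤ d) {s : ℝ} (hs0 : 0 < s) :
    ∃ C : ℝ, 0 < C ∧ ∀ A B : Space d →L[ℝ] Space d, IsUnit A → IsUnit B →
      singularValueFunction s (A * B) ≤
        C * (singularValueFunction s A * singularValueFunction s B) := by
  have hd' : (0 : ℝ) < d := by exact_mod_cast hd
  rcases le_or_gt s d with hs | hs
  · exact exists_singularValueFunction_mul_le_of_le hd hs0 hs
  · obtain ⟨C, hC, h⟩ := exists_singularValueFunction_mul_le_of_le hd hd' le_rfl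
    refine ⟨C ^ (s / d), by positivity, fun A B hA hB => ?_⟩
    simp only [singularValueFunction_eq_rpow hd hs]
    have pA := singularValueFunction_pos hd' hA
    have pB := singularValueFunction_pos hd' hB
    have pAB := singularValueFunction_pos hd' (hA.mul hB)
    rw [← Real.mul_rpow pA.le pB.le, ← Real.mul_rpow hC.le (by positivity)]
    exact Real.rpow_le_rpow pAB.le (h A B hA hB) (by positivity)

/-- A finite set of points of the unit ball whose images are more than `2 * r` apart carries
disjoint translates of a slab, so a maximal one gives an efficient cover of the image ellipsoid. -/
theorem exists_finset_cover_ellipsoid {d : ℕ} (A : Space d →L[ℝ] Space d) {r : ℝ}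
    (hpos : 0 < volume (slab A 1 r)) :
    ∃ F : Finset (Space d), (F.card : ℝ≥0∞) * volume (slab A 1 r) ≤
        volume (Metric.closedBall (0 : Space d) 2) ∧
      ∀ x, ‖x‖ ≤ 1 → ∃ p ∈ F, ‖A x - A p‖ ≤ 2 * r := by
  set good : Finset (Space d) → Prop := fun F =>
    (∀ p ∈ F, ‖p‖ ≤ 1) ∧ ∀ p ∈ F, ∀ q ∈ F, p ≠ q → 2 * r < ‖A p - A q‖ with hgood
  have hvf : volume (Metric.closedBall (0 : Space d) 2) ≠ ∞ :=
    (isCompact_closedBall _ _).measure_lt_top.ne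
  have hms : MeasurableSet (slab A 1 r) := (isClosed_slab A 1 r).measurableSet
  have hcard : ∀ F, good F → (F.card : ℝ≥0∞) * volume (slab A 1 r) ≤
      volume (Metric.closedBall (0 : Space d) 2) := by
    rintro F ⟨hF1, hF2⟩
    have hmeas : ∀ p ∈ F, MeasurableSet ((fun x => x - p) ⁻¹' slab A 1 r) := fun p _ =>
      measurable_id.sub_const p hms
    calc (F.card : ℝ≥0∞) * volume (slab A 1 r)
        = ∑ p ∈ F, volume ((fun x => x - p) ⁻¹' slab A 1 r) := by
          rw [Finset.sum_congr rfl fun p _ => by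
            rw [(measurePreserving_sub_right volume p).measure_preimage hms.nullMeasurableSet]]
          simp
      _ = volume (⋃ p ∈ F, (fun x => x - p) ⁻¹' slab A 1 r) := by
          refine (measure_biUnion_finset ?_ hmeas).symm
          intro p hp q hq hpq
          refine Set.disjoint_left.2 fun x hx1 hx2 => ?_
          have h1 := hF2 p hp q hq hpq
          have h2 : A p - A q = A (x - q) - A (x - p) := by simp only [map_sub]; abel
          rw [h2] at h1
          have h3 := (norm_sub_le (A (x - q)) (A (x - p))).trans (add_le_add hx2.2 hx1.2)
          linarith
      _ ≤ _ := by
          refine measure_mono (Set.iUnion₂_subset fun p hp x hx => ?_)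
          rw [mem_closedBall_zero_iff]
          calc ‖x‖ = ‖(x - p) + p‖ := by rw [sub_add_cancel]
            _ ≤ 1 + 1 := (norm_add_le _ _).trans (add_le_add hx.1 (hF1 p hp))
            _ = 2 := by norm_num
  obtain ⟨N, hN⟩ : ∃ N : ℕ, volume (Metric.closedBall (0 : Space d) 2) <
      N * volume (slab A 1 r) := ENNReal.exists_nat_mul_gt hpos.ne' hvf
  have hbdd : ∀ F, good F → F.card ≤ N := by
    intro F hF
    by_contra hlt
    refine (hN.trans_le ?_).not_ge (hcard F hF)
    gcongr
    omega
  have hex : ∃ k, ∃ F, good F ∧ F.card = k := ⟨0, ∅, by simp [hgood], rfl⟩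
  obtain ⟨F, hF, hFmax⟩ : ∃ F, good F ∧ ∀ G, good G → G.card ≤ F.card := by
    classical
    obtain ⟨F, hF, hFc⟩ := Nat.findGreatest_spec (P := fun k => ∃ F, good F ∧ F.card = k)
      (Nat.zero_le N) ⟨∅, by simp [hgood], rfl⟩
    refine ⟨F, hF, fun G hG => ?_⟩
    rw [hFc]
    exact Nat.le_findGreatest (hbdd G hG) ⟨G, hG, rfl⟩
  refine ⟨F, hcard F hF, fun x hx => ?_⟩
  by_contra! hfar
  classical
  have hr0 : 0 ≤ r := by
    by_contra hneg
    have : slab A 1 r = ∅ := by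
      ext y
      simp only [slab, Set.mem_ofPred_eq, Set.mem_empty_iff_false, iff_false, not_and, not_le]
      exact fun _ => (not_le.1 hneg).trans_le (norm_nonneg _)
    simp [this] at hpos
  have hxF : x ∉ F := by
    intro hxF
    have := hfar x hxF
    simp only [sub_self, norm_zero] at this
    linarith
  have := hFmax (insert x F) ⟨?_, ?_⟩
  · rw [Finset.card_insert_of_notMem hxF] at this
    omega
  · intro p hp
    rcases Finset.mem_insert.1 hp with rfl | hp
    exacts [hx, hF.1 p hp]
  · intro p hp q hq hpq
    rcases Finset.mem_insert.1 hp with rfl | hp' <;> rcases Finset.mem_insert.1 hq with rfl | hq'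
    · exact absurd rfl hpq
    · exact hfar q hq'
    · rw [norm_sub_rev]; exact hfar p hp'
    · exact hF.2 p hp' q hq' hpq

/-- The image of the unit ball under `A` has a cover by balls of radius `2 * critSV s A` whose
`s`-dimensional size is comparable to `φ^s(A)`. -/
theorem exists_cover_ellipsoid {d : ℕ} (hd : 1 ≤ d) {s : ℝ} (hs0 : 0 < s) (hs : s ≤ d) :
    ∃ C : ℝ, 0 < C ∧ ∀ A : Space d →L[ℝ] Space d, IsUnit A → ∃ F : Finset (Space d),
      F.card * critSV s A ^ s ≤ C * singularValueFunction s A ∧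
      ∀ x, ‖x‖ ≤ 1 → ∃ p ∈ F, ‖A x - p‖ ≤ 2 * critSV s A := by
  classical
  have hd' : (0 : ℝ) < d := by exact_mod_cast hd
  have hdsq : 0 < √(d : ℝ) := Real.sqrt_pos.2 hd'
  set v := volume.real (Metric.closedBall (0 : Space d) 2) with hv
  have hvf : volume (Metric.closedBall (0 : Space d) 2) ≠ ∞ :=
    (isCompact_closedBall _ _).measure_lt_top.ne
  have hv0 : 0 < v := by
    refine ENNReal.toReal_pos ?_ hvf
    exact (Metric.measure_closedBall_pos volume _ (by norm_num)).ne'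
  set c := (2 / √(d : ℝ)) ^ d
  have hc : 0 < c := by positivity
  refine ⟨v / c, by positivity, fun A hA => ?_⟩
  have hr := critSV_pos hs0 hs hA
  have pA := singularValueFunction_pos hs0 hA
  have hlow := le_volume_slab hd hs0 hs hA
  obtain ⟨F, hF1, hF2⟩ := exists_finset_cover_ellipsoid A (r := critSV s A)
    (lt_of_lt_of_le (ENNReal.ofReal_pos.2 (by positivity)) hlow)
  refine ⟨F.image A, ?_, fun x hx => ?_⟩
  · have h1 := (mul_le_mul_right hlow (F.card : ℝ≥0∞)).trans hF1
    rw [← ENNReal.ofReal_toReal hvf, ← ENNReal.ofReal_natCast,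
      ← ENNReal.ofReal_mul (by positivity),
      ENNReal.ofReal_le_ofReal_iff ENNReal.toReal_nonneg] at h1
    change (F.card : ℝ) * (c * (critSV s A ^ s / _)) ≤ v at h1
    have h2 : ((F.image A).card : ℝ) ≤ F.card := by exact_mod_cast Finset.card_image_le
    refine (mul_le_mul_of_nonneg_right h2 (by positivity)).trans ?_
    rw [div_mul_eq_mul_div, le_div_iff₀ hc]
    rw [← mul_div_assoc, ← mul_div_assoc, div_le_iff₀ pA] at h1
    linarith
  · obtain ⟨p, hp, hpx⟩ := hF2 x hx
    exact ⟨A p, Finset.mem_image_of_mem A hp, hpx⟩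

/-! ### Frostman's lemma on the tree of finite words -/

/-- The least value of `∑ H` over cut sets of the tree below `w` that use at most `k` further
letters. -/
noncomputable def cutValue {m : ℕ} (H : List (Fin m) → ℝ≥0∞) : ℕ → List (Fin m) → ℝ≥0∞
  | 0, w => H w
  | k + 1, w => min (H w) (∑ i, cutValue H k (w ++ [i]))

/-- The sum of `H` over the words that extend `v` by `n` letters. -/
noncomputable def levelSum {m : ℕ} (H : List (Fin m) → ℝ≥0∞) (n : ℕ) (v : List (Fin m)) : ℝ≥0∞ :=
  ∑ w : Fin n → Fin m, H (v ++ List.ofFn w)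

theorem levelSum_succ {m : ℕ} (H : List (Fin m) → ℝ≥0∞) (n : ℕ) (v : List (Fin m)) :
    levelSum H (n + 1) v = ∑ i, levelSum H n (v ++ [i]) := by
  unfold levelSum
  rw [← (Fin.consEquiv fun _ => Fin m).sum_comp, Fintype.sum_prod_type]
  refine Finset.sum_congr rfl fun i _ => Finset.sum_congr rfl fun u _ => ?_
  congr 1
  simp [Fin.consEquiv, List.ofFn_succ]

theorem cutValue_le {m : ℕ} (H : List (Fin m) → ℝ≥0∞) (k : ℕ) (w : List (Fin m)) :
    cutValue H k w ≤ H w := by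
  cases k
  · exact le_rfl
  · exact min_le_left _ _

theorem cutValue_antitone {m : ℕ} (H : List (Fin m) → ℝ≥0∞) (w : List (Fin m)) :
    Antitone fun k => cutValue H k w := by
  refine antitone_nat_of_succ_le fun k => ?_
  induction k generalizing w with
  | zero => exact cutValue_le H 1 w
  | succ k ih => exact min_le_min le_rfl (Finset.sum_le_sum fun i _ => ih _)

theorem iInf_cutValue_le_sum {m : ℕ} (H : List (Fin m) → ℝ≥0∞) (w : List (Fin m)) :
    ⨅ k, cutValue H k w ≤ ∑ i, ⨅ k, cutValue H k (w ++ [i]) := by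
  have ht : Tendsto (fun k => ∑ i, cutValue H k (w ++ [i])) atTop
      (𝓝 (∑ i, ⨅ k, cutValue H k (w ++ [i]))) :=
    tendsto_finsetSum _ fun i _ => tendsto_atTop_iInf (cutValue_antitone H _)
  refine ge_of_tendsto' ht fun k => (iInf_le _ (k + 1)).trans (min_le_right _ _)

theorem levelSum_append_le {m : ℕ} {H : List (Fin m) → ℝ≥0∞}
    (hsub : ∀ w u, H (w ++ u) ≤ H w * H u) (n : ℕ) (w : List (Fin m)) :
    levelSum H n w ≤ H w * levelSum H n [] := by
  unfold levelSum
  rw [Finset.mul_sum]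
  exact Finset.sum_le_sum fun u _ => hsub _ _

/-- A word with at least `k` further letters passes through every cut set that `cutValue H k`
takes into account; the part behind the cut contributes at most `M`. -/
theorem levelSum_le_cutValue_mul {m : ℕ} {H : List (Fin m) → ℝ≥0∞}
    (hsub : ∀ w u, H (w ++ u) ≤ H w * H u) {M : ℝ≥0∞} (k n : ℕ) (hkn : k ≤ n)
    (hM : ∀ j ≤ n, levelSum H j [] ≤ M) (w : List (Fin m)) :
    levelSum H n w ≤ cutValue H k w * M := by
  induction k generalizing n w with
  | zero => exact (levelSum_append_le hsub n w).trans (mul_le_mul_right (hM n le_rfl) _)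
  | succ k ih =>
    obtain ⟨n, rfl⟩ : ∃ n', n = n' + 1 := ⟨n - 1, by omega⟩
    rcases min_choice (H w) (∑ i, cutValue H k (w ++ [i])) with h | h
    · rw [cutValue, h]
      exact (levelSum_append_le hsub _ w).trans (mul_le_mul_right (hM _ le_rfl) _)
    · rw [cutValue, h, levelSum_succ, Finset.sum_mul]
      exact Finset.sum_le_sum fun i _ =>
        ih n (by omega) (fun j hj => hM j (by omega)) _

/-- A single cut set of small value bounds all level sums: long words factor through it. -/
theorem exists_levelSum_le {m : ℕ} {H : List (Fin m) → ℝ≥0∞}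
    (hsub : ∀ w u, H (w ++ u) ≤ H w * H u) (hfin : ∀ w, H w ≠ ∞) {k : ℕ}
    (hk : cutValue H k [] < 2⁻¹) : ∃ B : ℝ≥0∞, B ≠ ∞ ∧ ∀ n, levelSum H n [] ≤ B := by
  have hlf : ∀ n, levelSum H n [] ≠ ∞ := fun n => ENNReal.sum_ne_top.2 fun w _ => hfin _
  refine ⟨∑ j ∈ Finset.range k, levelSum H j [], ENNReal.sum_ne_top.2 fun j _ => hlf j,
    fun n => ?_⟩
  induction n using Nat.strong_induction_on with
  | _ n ih =>
    set B := ∑ j ∈ Finset.range k, levelSum H j []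
    rcases lt_or_ge n k with hn | hn
    · exact Finset.single_le_sum (f := fun j => levelSum H j []) (fun _ _ => zero_le)
        (Finset.mem_range.2 hn)
    · by_contra! hlt
      have h1 := levelSum_le_cutValue_mul hsub (M := levelSum H n []) k n hn (fun j hj => by
        rcases hj.lt_or_eq with hj | rfl
        · exact (ih j hj).trans hlt.le
        · exact le_rfl) []
      have h0 : levelSum H n [] ≠ 0 := (zero_le.trans_lt hlt).ne'
      have h2 : levelSum H n [] ≤ 2⁻¹ * levelSum H n [] :=
        h1.trans (mul_le_mul_left hk.le _)
      rw [mul_comm, ← div_eq_mul_inv] at h2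
      exact (ENNReal.half_lt_self h0 (hlf n)).not_ge h2

/-- If `b ≤ ∑ a i`, choosing `i` with probability proportional to `a i` gives `i` a probability of
at most `a i / b`. -/
theorem exists_measure_singleton_mul_le {m : ℕ} (hm : 1 ≤ m) (a : Fin m → ℝ≥0∞)
    (ha : ∀ i, a i ≠ ∞) {b : ℝ≥0∞} (hb : b ≤ ∑ i, a i) :
    ∃ p : Measure (Fin m), IsProbabilityMeasure p ∧ ∀ i, p {i} * b ≤ a i := by
  by_cases h0 : ∑ i, a i = 0
  · refine ⟨Measure.dirac ⟨0, hm⟩, inferInstance, fun i => ?_⟩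
    rw [h0, nonpos_iff_eq_zero] at hb
    simp [hb]
  · have hS : ∑ i, a i ≠ ∞ := ENNReal.sum_ne_top.2 fun i _ => ha i
    refine ⟨∑ i, (a i / ∑ j, a j) • Measure.dirac i, ⟨?_⟩, fun i => ?_⟩
    · simp only [Measure.coe_finsetSum, Measure.coe_smul, Finset.sum_apply, Pi.smul_apply,
        measure_univ, smul_eq_mul, mul_one]
      simp_rw [div_eq_mul_inv]
      rw [← Finset.sum_mul, ENNReal.mul_inv_cancel h0 hS]
    · have : (∑ i, (a i / ∑ j, a j) • Measure.dirac i) {i} = a i / ∑ j, a j := by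
        simp only [Measure.coe_finsetSum, Measure.coe_smul, Finset.sum_apply, Pi.smul_apply,
          smul_eq_mul, measurableSet_singleton, Measure.dirac_apply', Set.indicator_apply,
          Set.mem_singleton_iff, Pi.one_apply, mul_ite, mul_one, mul_zero]
        simp
      rw [this, ← ENNReal.mul_div_right_comm]
      exact ENNReal.div_le_of_le_mul (mul_le_mul_right hb _)

/-- The first `n` letters of an infinite word, as a list. -/
def initialList {m : ℕ} (v : ℕ → Fin m) (n : ℕ) : List (Fin m) := List.ofFn fun k : Fin n => v k

theorem initialList_succ {m : ℕ} (v : ℕ → Fin m) (n : ℕ) :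
    initialList v (n + 1) = initialList v n ++ [v n] := by
  unfold initialList
  rw [List.ofFn_succ_last]
  simp

theorem length_initialList {m : ℕ} (v : ℕ → Fin m) (n : ℕ) : (initialList v n).length = n := by
  simp [initialList]

/-- The node reached after `n` steps when at each node `w` of the tree the letter `U w` is
chosen. -/
def walk {m : ℕ} (U : List (Fin m) → Fin m) : ℕ → List (Fin m)
  | 0 => []
  | n + 1 => walk U n ++ [U (walk U n)]

theorem walk_eq_initialList {m : ℕ} (U : List (Fin m) → Fin m) (n : ℕ) :
    walk U n = initialList (fun k => U (walk U k)) n := by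
  induction n with
  | zero => simp [walk, initialList]
  | succ n ih => rw [initialList_succ, ← ih, walk]

theorem measurableSet_walk_eq {m : ℕ} (n : ℕ) (l : List (Fin m)) :
    MeasurableSet {U : List (Fin m) → Fin m | walk U n = l} := by
  induction n generalizing l with
  | zero => simp [walk]
  | succ n ih =>
    have : {U : List (Fin m) → Fin m | walk U (n + 1) = l} =
        ⋃ l' : List (Fin m), {U | walk U n = l'} ∩
          (fun U : List (Fin m) → Fin m => U l') ⁻¹' {x | l' ++ [x] = l} := by
      ext U
      simp [walk]
    rw [this]
    exact MeasurableSet.iUnion fun l' => (ih l').inter (measurable_pi_apply l' .of_discrete)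

theorem measurable_walk {m : ℕ} :
    Measurable fun (U : List (Fin m) → Fin m) (n : ℕ) => U (walk U n) := by
  refine measurable_pi_lambda _ fun n => measurable_to_countable' fun j => ?_
  have : (fun U : List (Fin m) → Fin m => U (walk U n)) ⁻¹' {j} =
      ⋃ l' : List (Fin m), {U | walk U n = l'} ∩
        (fun U : List (Fin m) → Fin m => U l') ⁻¹' {j} := by
    ext U
    simp
  rw [this]
  exact MeasurableSet.iUnion fun l' => (measurableSet_walk_eq n l').inter
    (measurable_pi_apply l' (measurableSet_singleton j))

/-- The infinite words that begin with `w`. -/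
def cyl {m n : ℕ} (w : Fin n → Fin m) : Set (ℕ → Fin m) := {i | ∀ k : Fin n, i k = w k}

theorem measurableSet_cyl {m n : ℕ} (w : Fin n → Fin m) : MeasurableSet (cyl w) := by
  have : cyl w = ⋂ k : Fin n, (fun i : ℕ → Fin m => i k) ⁻¹' {w k} := by
    ext i; simp [cyl]
  rw [this]
  exact MeasurableSet.iInter fun k => measurable_pi_apply _ (measurableSet_singleton _)

/-- A subadditive function on the tree of finite words dominates a measure: a random walk down the
tree, with independent steps, chooses each child with probability at most its share. -/
theorem exists_measure_cyl_mul_le {m : ℕ} (hm : 1 ≤ m) (h : List (Fin m) → ℝ≥0∞)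
    (hfin : ∀ w, h w ≠ ∞) (hsum : ∀ w, h w ≤ ∑ i, h (w ++ [i])) :
    ∃ μ : Measure (ℕ → Fin m), IsProbabilityMeasure μ ∧
      ∀ (n : ℕ) (w : Fin n → Fin m), μ (cyl w) * h [] ≤ h (List.ofFn w) := by
  choose p hp1 hp2 using fun w =>
    exists_measure_singleton_mul_le hm (fun i => h (w ++ [i])) (fun i => hfin _) (hsum w)
  set P := Measure.infinitePi p
  refine ⟨P.map fun U n => U (walk U n), Measure.isProbabilityMeasure_map
    measurable_walk.aemeasurable, fun n w => ?_⟩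
  rw [Measure.map_apply measurable_walk (measurableSet_cyl w)]
  -- an arbitrary infinite word that begins with `w`
  set v : ℕ → Fin m := fun k => if hk : k < n then w ⟨k, hk⟩ else ⟨0, hm⟩ with hv
  have hvw : ∀ k : Fin n, v k = w k := fun k => by simp [hv]
  have hpre : initialList v n = List.ofFn w := congrArg List.ofFn (funext hvw)
  classical
  set s : Finset (List (Fin m)) := (Finset.range n).image (initialList v)
  have hinj : Function.Injective (initialList v) := fun a b hab => by
    rw [← length_initialList v a, hab, length_initialList]
  have hsub : (fun (U : List (Fin m) → Fin m) (n : ℕ) => U (walk U n)) ⁻¹' cyl w ⊆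
      Set.pi s fun l => {v l.length} := by
    intro U hU l hl
    obtain ⟨k, hk, rfl⟩ := Finset.mem_image.1 (Finset.mem_coe.1 hl)
    rw [Finset.mem_range] at hk
    have hU' : ∀ k < n, U (walk U k) = v k := fun k hk => by
      rw [hvw ⟨k, hk⟩]
      exact hU ⟨k, hk⟩
    have : walk U k = initialList v k := by
      rw [walk_eq_initialList]
      exact congrArg List.ofFn (funext fun j : Fin k => hU' j (j.2.trans hk))
    rw [Set.mem_singleton_iff, length_initialList, ← hU' k hk, this]
  have hprod : P (Set.pi s fun l => {v l.length}) =
      ∏ k ∈ Finset.range n, p (initialList v k) {v k} := by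
    rw [Measure.infinitePi_pi _ fun _ _ => measurableSet_singleton _,
      Finset.prod_image fun a _ b _ hab => hinj hab]
    simp only [length_initialList]
  have hind : ∀ n, (∏ k ∈ Finset.range n, p (initialList v k) {v k}) * h [] ≤
      h (initialList v n) := by
    intro n
    induction n with
    | zero => simp [initialList]
    | succ n ih =>
      rw [Finset.prod_range_succ, mul_comm _ (p _ _), mul_assoc, initialList_succ]
      exact (mul_le_mul_right ih _).trans (hp2 _ _)
  rw [← hpre]
  exact (mul_le_mul_left ((measure_mono hsub).trans hprod.le) _).trans (hind n)

/-- **Frostman's lemma** on the tree of finite words, for a submultiplicative weight. -/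
theorem exists_measure_cyl_le {m : ℕ} (hm : 1 ≤ m) {H : List (Fin m) → ℝ≥0∞}
    (hsub : ∀ w u, H (w ++ u) ≤ H w * H u) (hfin : ∀ w, H w ≠ ∞)
    (hunb : ¬ ∃ B : ℝ≥0∞, B ≠ ∞ ∧ ∀ n, levelSum H n [] ≤ B) :
    ∃ μ : Measure (ℕ → Fin m), IsProbabilityMeasure μ ∧
      ∀ (n : ℕ) (w : Fin n → Fin m), μ (cyl w) ≤ 2 * H (List.ofFn w) := by
  have hlow : 2⁻¹ ≤ ⨅ k, cutValue H k [] :=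
    le_iInf fun k => not_lt.1 fun hk => hunb (exists_levelSum_le hsub hfin hk)
  obtain ⟨μ, hμ, h⟩ := exists_measure_cyl_mul_le hm (fun w => ⨅ k, cutValue H k w)
    (fun w => ((iInf_le _ 0).trans_lt (hfin w).lt_top).ne) (iInf_cutValue_le_sum H)
  refine ⟨μ, hμ, fun n w => ?_⟩
  have h1 := (mul_le_mul_right hlow (μ (cyl w))).trans ((h n w).trans (iInf_le _ 0))
  rw [← div_eq_mul_inv, ENNReal.div_le_iff (by norm_num) (by norm_num), mul_comm] at h1
  exact h1

/-! ### Products along words and the coding map -/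

theorem exists_norm_le_lt_one {d m : ℕ} {T : Fin m → Space d →L[ℝ] Space d}
    (hT : ∀ i, ‖T i‖ < 1) : ∃ L : ℝ, 0 < L ∧ L < 1 ∧ ∀ i, ‖T i‖ ≤ L := by
  rcases isEmpty_or_nonempty (Fin m) with h | h
  · exact ⟨1 / 2, by norm_num, by norm_num, fun i => h.elim i⟩
  · obtain ⟨i₀, hi₀⟩ := Finite.exists_max fun i => ‖T i‖
    exact ⟨max (1 / 2) ‖T i₀‖, lt_max_of_lt_left (by norm_num), max_lt (by norm_num) (hT i₀),
      fun i => (hi₀ i).trans (le_max_right _ _)⟩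

theorem isUnit_wordProd {d m : ℕ} {T : Fin m → Space d →L[ℝ] Space d}
    (hT : ∀ i, IsUnit (T i)) {n : ℕ} (w : Fin n → Fin m) : IsUnit (wordProd T w) :=
  List.prod_isUnit fun A hA => by
    obtain ⟨k, rfl⟩ := List.mem_ofFn.1 hA
    exact hT _

theorem wordProd_castSucc {d m : ℕ} (T : Fin m → Space d →L[ℝ] Space d) {n : ℕ}
    (w : Fin (n + 1) → Fin m) :
    wordProd T w = wordProd T (fun k : Fin n => w k.castSucc) * T (w (Fin.last n)) := by
  unfold wordProd
  rw [List.ofFn_succ_last]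
  simp

theorem norm_wordProd_le {d m : ℕ} {T : Fin m → Space d →L[ℝ] Space d} {L : ℝ} (hL : 0 ≤ L)
    (hT : ∀ i, ‖T i‖ ≤ L) {n : ℕ} (w : Fin n → Fin m) : ‖wordProd T w‖ ≤ L ^ n := by
  induction n with
  | zero =>
    simp only [wordProd, List.ofFn_zero, List.prod_nil, pow_zero]
    exact ContinuousLinearMap.norm_id_le
  | succ n ih =>
    rw [wordProd_castSucc, pow_succ]
    exact (ContinuousLinearMap.opNorm_comp_le _ _).trans
      (mul_le_mul (ih _) (hT _) (norm_nonneg _) (by positivity))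

theorem singularValueFunction_wordProd_le_mul {d m : ℕ} (hd : 1 ≤ d)
    {T : Fin m → Space d →L[ℝ] Space d} (hTu : ∀ i, IsUnit (T i)) {L : ℝ} (hL : 0 ≤ L)
    (hT : ∀ i, ‖T i‖ ≤ L) {s t : ℝ} (hs0 : 0 < s) (hst : s ≤ t) {n : ℕ} (w : Fin n → Fin m) :
    singularValueFunction t (wordProd T w) ≤
      (L ^ (t - s)) ^ n * singularValueFunction s (wordProd T w) := by
  refine (singularValueFunction_le_mul hd hs0 hst (isUnit_wordProd hTu w)
    (norm_wordProd_le hL hT w)).trans (le_of_eq ?_)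
  rw [← Real.rpow_natCast, ← Real.rpow_natCast, ← Real.rpow_mul hL, ← Real.rpow_mul hL,
    mul_comm (n : ℝ)]

/-- Divergence of the series at an exponent beyond `s` produces a measure whose cylinders are
bounded by `φ^s`. -/
theorem exists_frostman_measure {d m : ℕ} (hd : 1 ≤ d) (hm : 1 ≤ m)
    {T : Fin m → Space d →L[ℝ] Space d} (hTu : ∀ i, IsUnit (T i)) (hT : ∀ i, ‖T i‖ < 1)
    {s t : ℝ} (hs0 : 0 < s) (hst : s < t)
    (hdiv : ¬ Summable fun n : ℕ => ∑ w : Fin n → Fin m, singularValueFunction t (wordProd T w)) :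
    ∃ μ : Measure (ℕ → Fin m), IsProbabilityMeasure μ ∧ ∃ C : ℝ, 0 < C ∧
      ∀ (n : ℕ) (w : Fin n → Fin m),
        μ (cyl w) ≤ ENNReal.ofReal (C * singularValueFunction s (wordProd T w)) := by
  obtain ⟨L, hL0, hL1, hL⟩ := exists_norm_le_lt_one hT
  obtain ⟨C, hC, hmul⟩ := exists_singularValueFunction_mul_le hd hs0
  have hu : ∀ l : List (Fin m), IsUnit (l.map T).prod := fun l =>
    List.prod_isUnit fun A hA => by
      obtain ⟨k, _, rfl⟩ := List.mem_map.1 hA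
      exact hTu _
  have hword : ∀ {n : ℕ} (w : Fin n → Fin m), ((List.ofFn w).map T).prod = wordProd T w := by
    intro n w
    rw [List.map_ofFn]
    rfl
  set H : List (Fin m) → ℝ≥0∞ := fun l =>
    ENNReal.ofReal (C * singularValueFunction s (l.map T).prod) with hH
  have hsub : ∀ w u, H (w ++ u) ≤ H w * H u := by
    intro w u
    have := singularValueFunction_pos hs0 (hu w)
    rw [hH, ← ENNReal.ofReal_mul (by positivity)]
    refine ENNReal.ofReal_le_ofReal ?_
    rw [List.map_append, List.prod_append]
    calc _ ≤ C * (C * _) := mul_le_mul_of_nonneg_left (hmul _ _ (hu w) (hu u)) hC.le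
      _ = _ := by ring
  have hunb : ¬ ∃ B : ℝ≥0∞, B ≠ ∞ ∧ ∀ n, levelSum H n [] ≤ B := by
    rintro ⟨B, hB, hBn⟩
    refine hdiv ?_
    have hρ0 : 0 ≤ L ^ (t - s) := by positivity
    have hρ1 : L ^ (t - s) < 1 := Real.rpow_lt_one hL0.le hL1 (sub_pos.2 hst)
    refine Summable.of_nonneg_of_le
      (fun n => Finset.sum_nonneg fun w _ => singularValueFunction_nonneg (hs0.trans hst) _)
      (fun n => ?_) ((summable_geometric_of_lt_one hρ0 hρ1).mul_right (B.toReal / C))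
    have h1 := hBn n
    have h2 : levelSum H n [] =
        ENNReal.ofReal (C * ∑ w : Fin n → Fin m, singularValueFunction s (wordProd T w)) := by
      rw [Finset.mul_sum, ENNReal.ofReal_sum_of_nonneg fun w _ =>
        mul_nonneg hC.le (singularValueFunction_nonneg hs0 _)]
      refine Finset.sum_congr rfl fun w _ => ?_
      rw [List.nil_append, hH, ← hword]
    rw [h2, ENNReal.ofReal_le_iff_le_toReal hB, mul_comm, ← le_div_iff₀ hC] at h1
    refine le_trans ?_ (mul_le_mul_of_nonneg_left h1 (pow_nonneg hρ0 n))
    rw [Finset.mul_sum]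
    exact Finset.sum_le_sum fun w _ =>
      singularValueFunction_wordProd_le_mul hd hTu hL0.le hL hs0 hst.le w
  obtain ⟨μ, hμ, h⟩ := exists_measure_cyl_le hm hsub (fun _ => ENNReal.ofReal_ne_top) hunb
  refine ⟨μ, hμ, 2 * C, by positivity, fun n w => (h n w).trans (le_of_eq ?_)⟩
  simp only [hH]
  rw [hword, mul_assoc, ENNReal.ofReal_mul zero_le_two, ENNReal.ofReal_ofNat]

/-- The product `T_{i_0} ⋯ T_{i_{n-1}}` along an initial segment of an infinite word. -/
noncomputable def prefixProd {d m : ℕ} (T : Fin m → Space d →L[ℝ] Space d) (i : ℕ → Fin m)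
    (n : ℕ) : Space d →L[ℝ] Space d := wordProd T fun k : Fin n => i k

theorem prefixProd_zero {d m : ℕ} (T : Fin m → Space d →L[ℝ] Space d) (i : ℕ → Fin m) :
    prefixProd T i 0 = 1 := by simp [prefixProd, wordProd]

theorem prefixProd_succ {d m : ℕ} (T : Fin m → Space d →L[ℝ] Space d) (i : ℕ → Fin m) (n : ℕ) :
    prefixProd T i (n + 1) = prefixProd T i n * T (i n) := wordProd_castSucc T _

theorem prefixProd_add {d m : ℕ} (T : Fin m → Space d →L[ℝ] Space d) (i : ℕ → Fin m) (n k : ℕ) :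
    prefixProd T i (n + k) = prefixProd T i n * prefixProd T (fun j => i (n + j)) k := by
  induction k with
  | zero => rw [prefixProd_zero, mul_one, add_zero]
  | succ k ih => rw [← add_assoc, prefixProd_succ, ih, prefixProd_succ, mul_assoc]

theorem perturbedComp_eq_sum {d m : ℕ} (T : Fin m → Space d →L[ℝ] Space d) (a : Fin m → Space d)
    (y : Word m → Space d) (i : ℕ → Fin m) (n : ℕ) (x : Space d) :
    perturbedComp T a y i n x =
      ∑ k ∈ Finset.range n, prefixProd T i k (a (i k) + y (restrict i k)) + prefixProd T i n x := by
  induction n generalizing x with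
  | zero => simp [perturbedComp, prefixProd_zero]
  | succ n ih =>
    have h : perturbedMap T a y (restrict i n) x = T (i n) x + (a (i n) + y (restrict i n)) := by
      simp only [perturbedMap, restrict, Fin.val_last]
      abel
    rw [perturbedComp, Function.comp_apply, h, ih, Finset.sum_range_succ, prefixProd_succ,
      mul_apply_eq_comp, map_add]
    abel

theorem perturbedComp_zero_apply {d m : ℕ} (T : Fin m → Space d →L[ℝ] Space d)
    (a : Fin m → Space d) (y : Word m → Space d) (i : ℕ → Fin m) (n : ℕ) :
    perturbedComp T a y i n 0 =
      ∑ k ∈ Finset.range n, prefixProd T i k (a (i k) + y (restrict i k)) := by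
  rw [perturbedComp_eq_sum, map_zero, add_zero]

/-- The translation parts `a_{i_n} + y_{i_0, …, i_n}` grow at most like `τ ^ n`. -/
def GrowthBound {d m : ℕ} (a : Fin m → Space d) (y : Word m → Space d) (C τ : ℝ) : Prop :=
  ∀ (i : ℕ → Fin m) (n : ℕ), ‖a (i n) + y (restrict i n)‖ ≤ C * τ ^ n

theorem GrowthBound.norm_term_le {d m : ℕ} {T : Fin m → Space d →L[ℝ] Space d}
    {a : Fin m → Space d} {y : Word m → Space d} {C τ L : ℝ} (hL0 : 0 ≤ L)
    (hL : ∀ i, ‖T i‖ ≤ L) (h : GrowthBound a y C τ) (i : ℕ → Fin m) (n : ℕ) :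
    ‖prefixProd T i n (a (i n) + y (restrict i n))‖ ≤ C * (L * τ) ^ n := by
  calc _ ≤ L ^ n * (C * τ ^ n) := (ContinuousLinearMap.le_opNorm _ _).trans
        (mul_le_mul (norm_wordProd_le hL0 hL _) (h i n) (norm_nonneg _) (by positivity))
    _ = _ := by rw [mul_pow]; ring

theorem GrowthBound.isWellDefined {d m : ℕ} {T : Fin m → Space d →L[ℝ] Space d}
    {a : Fin m → Space d} {y : Word m → Space d} {C τ L : ℝ} (hL0 : 0 ≤ L) (hτ : 0 ≤ τ)
    (hL : ∀ i, ‖T i‖ ≤ L) (hLτ : L * τ < 1) (h : GrowthBound a y C τ) : IsWellDefined T a y := by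
  intro i
  have hs : Summable fun n => prefixProd T i n (a (i n) + y (restrict i n)) :=
    Summable.of_norm_bounded ((summable_geometric_of_lt_one (by positivity) hLτ).mul_left C)
      (h.norm_term_le hL0 hL i)
  refine ⟨_, ((tendsto_add_atTop_iff_nat 1).2 hs.hasSum.tendsto_sum_nat).congr fun r => ?_⟩
  rw [perturbedComp_zero_apply]

theorem IsWellDefined.tendsto_codingMap {d m : ℕ} {T : Fin m → Space d →L[ℝ] Space d}
    {a : Fin m → Space d} {y : Word m → Space d} (h : IsWellDefined T a y) (i : ℕ → Fin m) :
    Tendsto (fun r => perturbedComp T a y i r 0) atTop (𝓝 (codingMap T a y i)) :=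
  (tendsto_add_atTop_iff_nat 1).1 (tendsto_nhds_limUnder (h i))

/-- The cylinder of an initial segment of length `n` is coded into an affine image, with linear
part `T_{i_0} ⋯ T_{i_{n-1}}`, of a ball whose radius is of order `τ ^ n`. -/
theorem GrowthBound.exists_codingMap_eq {d m : ℕ} {T : Fin m → Space d →L[ℝ] Space d}
    {a : Fin m → Space d} {y : Word m → Space d} {C τ L : ℝ} (hL0 : 0 ≤ L) (hτ : 0 ≤ τ)
    (hL : ∀ i, ‖T i‖ ≤ L) (hLτ : L * τ < 1) (h : GrowthBound a y C τ) (i : ℕ → Fin m) (n : ℕ) :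
    ∃ z : Space d, ‖z‖ ≤ C / (1 - L * τ) * τ ^ n ∧
      codingMap T a y i = perturbedComp T a y i n 0 + prefixProd T i n z := by
  have hC : 0 ≤ C := by simpa using (norm_nonneg _).trans (h i 0)
  set R := C / (1 - L * τ) * τ ^ n
  set K : Set (Space d) :=
    (fun z => perturbedComp T a y i n 0 + prefixProd T i n z) '' Metric.closedBall 0 R
  have hK : IsClosed K :=
    ((isCompact_closedBall (0 : Space d) R).image (by fun_prop)).isClosed
  have hmem : ∀ k, perturbedComp T a y i (n + k) 0 ∈ K := by
    intro k
    refine ⟨∑ j ∈ Finset.range k, prefixProd T (fun l => i (n + l)) j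
      (a (i (n + j)) + y (restrict i (n + j))), ?_, ?_⟩
    · rw [mem_closedBall_zero_iff]
      calc _ ≤ ∑ j ∈ Finset.range k, C * τ ^ n * (L * τ) ^ j := by
            refine norm_sum_le_of_le _ fun j _ => ?_
            calc _ ≤ L ^ j * (C * τ ^ (n + j)) := (ContinuousLinearMap.le_opNorm _ _).trans
                  (mul_le_mul (norm_wordProd_le hL0 hL _) (h i _) (norm_nonneg _) (by positivity))
              _ = _ := by rw [mul_pow, pow_add]; ring
        _ ≤ C * τ ^ n * (1 - L * τ)⁻¹ := by
            rw [← Finset.mul_sum, ← tsum_geometric_of_lt_one (by positivity) hLτ]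
            gcongr
            exact (summable_geometric_of_lt_one (by positivity) hLτ).sum_le_tsum _
              fun _ _ => by positivity
        _ = R := by simp only [R, div_eq_mul_inv]; ring
    · simp only [perturbedComp_zero_apply, map_sum]
      rw [Finset.sum_range_add]
      congr 1
      refine Finset.sum_congr rfl fun j _ => ?_
      rw [prefixProd_add, mul_apply_eq_comp]
  obtain ⟨z, hz, hzeq⟩ := hK.mem_of_tendsto
    (((h.isWellDefined hL0 hτ hL hLτ).tendsto_codingMap i).comp (tendsto_add_atTop_nat n))
    (Eventually.of_forall fun k => by
      rw [Function.comp_apply, add_comm]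
      exact hmem k)
  exact ⟨z, mem_closedBall_zero_iff.1 hz, hzeq.symm⟩

theorem perturbedComp_congr {d m : ℕ} (T : Fin m → Space d →L[ℝ] Space d) (a : Fin m → Space d)
    (y : Word m → Space d) {i j : ℕ → Fin m} {n : ℕ} (hij : ∀ k < n, i k = j k) :
    perturbedComp T a y i n 0 = perturbedComp T a y j n 0 := by
  simp only [perturbedComp_zero_apply]
  refine Finset.sum_congr rfl fun k hk => ?_
  rw [Finset.mem_range] at hk
  have h1 : restrict i k = restrict j k := by
    simp only [restrict]
    congr 1
    ext l
    rw [hij l (by omega)]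
  have h2 : prefixProd T i k = prefixProd T j k := by
    unfold prefixProd
    congr 1
    ext l
    rw [hij l (by omega)]
  rw [h1, h2, hij k hk]

theorem restrict_eq_restrict_iff {m : ℕ} {i j : ℕ → Fin m} {k n : ℕ} :
    restrict i k = restrict j n ↔ k = n ∧ ∀ l ≤ n, i l = j l := by
  constructor
  · intro h
    obtain rfl : k = n := congrArg Sigma.fst h
    refine ⟨rfl, fun l hl => ?_⟩
    have h2 := eq_of_heq (Sigma.mk.inj h).2
    exact congrFun h2 ⟨l, by omega⟩
  · rintro ⟨rfl, h⟩
    simp only [restrict]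
    congr 1
    ext l
    rw [h l (by omega)]

/-- Resampling the perturbation at the node `(i_0, …, i_n)` translates `Π(i)` by its image under
`T_{i_0} ⋯ T_{i_{n-1}}`, and does not affect the points coded by words outside the cylinder of that
node. -/
theorem IsWellDefined.codingMap_update_sub {d m : ℕ} {T : Fin m → Space d →L[ℝ] Space d}
    {a : Fin m → Space d} {y : Word m → Space d} (h : IsWellDefined T a y) {i j : ℕ → Fin m}
    {n : ℕ} (hij : i n ≠ j n) [DecidableEq (Word m)] (z : Space d) :
    codingMap T a (Function.update y (restrict i n) z) i -
        codingMap T a (Function.update y (restrict i n) z) j =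
      prefixProd T i n z + (codingMap T a y i - codingMap T a y j -
        prefixProd T i n (y (restrict i n))) := by
  have hj : ∀ r, perturbedComp T a (Function.update y (restrict i n) z) j r 0
      = perturbedComp T a y j r 0 := by
    intro r
    simp only [perturbedComp_zero_apply]
    refine Finset.sum_congr rfl fun k _ => ?_
    rw [Function.update_of_ne]
    intro hk
    obtain ⟨rfl, h2⟩ := restrict_eq_restrict_iff.1 hk
    exact hij (h2 k le_rfl).symm
  have hi : ∀ r, n < r → perturbedComp T a (Function.update y (restrict i n) z) i r 0
      = perturbedComp T a y i r 0 + prefixProd T i n (z - y (restrict i n)) := by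
    intro r hr
    simp only [perturbedComp_zero_apply]
    rw [← Finset.sum_erase_add _ _ (Finset.mem_range.2 hr),
      ← Finset.sum_erase_add (Finset.range r) _ (Finset.mem_range.2 hr),
      Function.update_self, add_assoc, ← map_add]
    congr 1
    · refine Finset.sum_congr rfl fun k hk => ?_
      rw [Function.update_of_ne]
      intro hk'
      exact (Finset.mem_erase.1 hk).1 (restrict_eq_restrict_iff.1 hk').1
    · congr 1
      abel
  have ti : Tendsto (fun r => perturbedComp T a (Function.update y (restrict i n) z) i (r + 1) 0)
      atTop (𝓝 (codingMap T a y i + prefixProd T i n (z - y (restrict i n)))) := by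
    have := ((tendsto_add_atTop_iff_nat 1).2 (h.tendsto_codingMap i)).add_const
      (prefixProd T i n (z - y (restrict i n)))
    refine this.congr' ?_
    filter_upwards [eventually_ge_atTop n] with r hr
    rw [hi _ (by omega)]
  have tj : Tendsto (fun r => perturbedComp T a (Function.update y (restrict i n) z) j (r + 1) 0)
      atTop (𝓝 (codingMap T a y j)) := by
    refine ((tendsto_add_atTop_iff_nat 1).2 (h.tendsto_codingMap j)).congr fun r => ?_
    rw [hj]
  have ei : codingMap T a (Function.update y (restrict i n) z) i = _ := ti.limUnder_eq
  have ej : codingMap T a (Function.update y (restrict i n) z) j = _ := tj.limUnder_eq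
  rw [ei, ej, map_sub]
  abel

/-! ### Growth of the perturbations and the upper bound for the dimension -/

/-- By the Borel–Cantelli lemma, all but finitely many perturbations `y_w` satisfy
`‖y_w‖ ≤ τ ^ |w|`: the decay of `η` beats the number of words. -/
theorem ae_exists_growthBound {d m : ℕ} (hm : 1 ≤ m) (a : Fin m → Space d)
    (η : Measure (Space d)) [IsProbabilityMeasure η] (hη : HasSuperpolynomialDecay η)
    {τ : ℝ} (hτ : 1 < τ) :
    ∀ᵐ y ∂(perturbationLaw m η), ∃ C, 0 < C ∧ GrowthBound a y C τ := by
  have hτ0 : 0 < τ := zero_lt_one.trans hτ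
  have hm0 : (0 : ℝ) < m := by exact_mod_cast hm
  obtain ⟨k, hk⟩ : ∃ k : ℕ, (m : ℝ) < τ ^ k := pow_unbounded_of_one_lt _ hτ
  obtain ⟨c, hc⟩ := hη k
  set q : ℝ := m / τ ^ k with hq
  have hq0 : 0 ≤ q := by positivity
  have hq1 : q < 1 := (div_lt_one (by positivity)).2 hk
  have hmeas : ∀ w : Word m, (perturbationLaw m η) {y | τ ^ w.1 < ‖y w‖} ≤
      ENNReal.ofReal (c / (τ ^ w.1) ^ k) := by
    intro w
    have h1 : MeasurableSet {x : Space d | τ ^ w.1 < ‖x‖} :=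
      (isOpen_lt continuous_const continuous_norm).measurableSet
    have h2 := (measurePreserving_eval_infinitePi (fun _ : Word m => η) w).measure_preimage
      h1.nullMeasurableSet
    have h3 := hc (τ ^ w.1) (by positivity)
    rw [Measure.real, ← ENNReal.le_ofReal_iff_toReal_le (measure_ne_top _ _)] at h3
    · exact h2.le.trans h3
    · exact ENNReal.toReal_nonneg.trans h3
  have hsum : ∑' w : Word m, (perturbationLaw m η) {y | τ ^ w.1 < ‖y w‖} ≠ ∞ := by
    refine ne_top_of_le_ne_top ?_ (ENNReal.tsum_le_tsum hmeas)
    rw [ENNReal.tsum_sigma']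
    have h1 : ∀ n : ℕ, ∑' w : Fin (n + 1) → Fin m,
        ENNReal.ofReal (c / (τ ^ (⟨n, w⟩ : Word m).1) ^ k) ≤
          ENNReal.ofReal (m * |c| * q ^ n) := by
      intro n
      rw [tsum_fintype]
      simp only
      rw [Finset.sum_const, Finset.card_univ, Fintype.card_fun, Fintype.card_fin,
        Fintype.card_fin, nsmul_eq_mul, ← ENNReal.ofReal_natCast,
        ← ENNReal.ofReal_mul (by positivity)]
      refine ENNReal.ofReal_le_ofReal ?_
      have : (m : ℝ) * |c| * q ^ n = ((m ^ (n + 1) : ℕ) : ℝ) * (|c| / (τ ^ n) ^ k) := by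
        rw [hq, div_pow, ← pow_mul, ← pow_mul, mul_comm k n]
        push_cast
        ring
      rw [this]
      gcongr
      exact le_abs_self c
    refine ne_top_of_le_ne_top ?_ (ENNReal.tsum_le_tsum h1)
    rw [← ENNReal.ofReal_tsum_of_nonneg (fun n => by positivity)
      ((summable_geometric_of_lt_one hq0 hq1).mul_left _)]
    exact ENNReal.ofReal_ne_top
  filter_upwards [ae_finite_setOfPred_mem hsum] with y hy
  obtain ⟨M, hM⟩ := (hy.image fun w => ‖y w‖).bddAbove
  obtain ⟨A, hA⟩ := (Set.finite_range fun i => ‖a i‖).bddAbove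
  refine ⟨|A| + max 1 M, by positivity, fun i n => ?_⟩
  have h1 : 1 ≤ τ ^ n := one_le_pow₀ hτ.le
  have ha : ‖a (i n)‖ ≤ |A| * τ ^ n := by
    refine (hA ⟨i n, rfl⟩).trans ((le_abs_self A).trans ?_)
    exact le_mul_of_one_le_right (abs_nonneg A) h1
  have hyw : ‖y (restrict i n)‖ ≤ max 1 M * τ ^ n := by
    by_cases hw : τ ^ n < ‖y (restrict i n)‖
    · refine (hM ⟨restrict i n, hw, rfl⟩).trans ((le_max_right 1 M).trans ?_)
      exact le_mul_of_one_le_right (zero_le_one.trans (le_max_left _ _)) h1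
    · refine (not_lt.1 hw).trans ?_
      exact le_mul_of_one_le_left (by positivity) (le_max_left _ _)
  rw [add_mul]
  exact (norm_add_le _ _).trans (add_le_add ha hyw)

/-- Almost surely the translation parts grow at a rate that the contraction of the `T_i` beats. -/
theorem ae_exists_growthBound_mul_lt_one {d m : ℕ} (hm : 1 ≤ m) {T : Fin m → Space d →L[ℝ] Space d}
    (hT : ∀ i, ‖T i‖ < 1) (a : Fin m → Space d)
    (η : Measure (Space d)) [IsProbabilityMeasure η] (hη : HasSuperpolynomialDecay η) :
    ∀ᵐ y ∂(perturbationLaw m η), ∃ C τ L : ℝ, 0 < C ∧ 1 < τ ∧ 0 < L ∧ (∀ i, ‖T i‖ ≤ L) ∧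
      L * τ < 1 ∧ GrowthBound a y C τ := by
  obtain ⟨L, hL0, hL1, hL⟩ := exists_norm_le_lt_one hT
  obtain ⟨τ, hτ1, hτL⟩ := exists_between ((one_lt_inv₀ hL0).2 hL1)
  filter_upwards [ae_exists_growthBound hm a η hη hτ1] with y ⟨C, hC, hy⟩
  refine ⟨C, τ, L, hC, hτ1, hL0, hL, ?_, hy⟩
  calc L * τ < L * L⁻¹ := mul_lt_mul_of_pos_left hτL hL0
    _ = 1 := mul_inv_cancel₀ hL0.ne'

/-- Covering the image of each cylinder of length `n` by balls of radius comparable to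
`critSV s (T_w)` bounds the `s`-dimensional Hausdorff measure of the attractor. -/
theorem GrowthBound.dimH_attractor_le {d m : ℕ} (hd : 1 ≤ d) (hm : 1 ≤ m)
    {T : Fin m → Space d →L[ℝ] Space d}
    (hTu : ∀ i, IsUnit (T i)) {a : Fin m → Space d} {y : Word m → Space d} {C τ L s₀ : ℝ} {s : ℝ≥0}
    (hC : 0 < C) (hL0 : 0 < L) (hτ : 0 < τ) (hL : ∀ i, ‖T i‖ ≤ L) (hLτ : L * τ < 1)
    (h : GrowthBound a y C τ) (hs₀ : 0 < s₀) (hs₀s : s₀ < s) (hs : (s : ℝ) ≤ d)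
    (hτs : τ ^ (s : ℝ) * L ^ (s - s₀) ≤ 1)
    (hsum : Summable fun n : ℕ => ∑ w : Fin n → Fin m, singularValueFunction s₀ (wordProd T w)) :
    dimH (attractor T a y) ≤ s := by
  have hs0 : (0 : ℝ) < s := hs₀.trans hs₀s
  obtain ⟨K, hK, hcov⟩ := exists_cover_ellipsoid hd hs0 hs
  choose F hF1 hF2 using fun (n : ℕ) (w : Fin n → Fin m) =>
    hcov (wordProd T w) (isUnit_wordProd hTu w)
  set R : ℕ → ℝ := fun n => C / (1 - L * τ) * τ ^ n with hR
  have hR₀ : 0 < C / (1 - L * τ) := div_pos hC (sub_pos.2 hLτ)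
  have hRpos : ∀ n, 0 < R n := fun n => by positivity
  -- `e n w` is an arbitrary infinite word that begins with `w`
  set e : ∀ n : ℕ, (Fin n → Fin m) → ℕ → Fin m := fun n w k =>
    if hk : k < n then w ⟨k, hk⟩ else ⟨0, hm⟩ with he
  set t : ∀ n : ℕ, (Σ w : Fin n → Fin m, F n w) → Set (Space d) := fun n p =>
    Metric.closedBall (perturbedComp T a y (e n p.1) n 0 + R n • (p.2 : Space d))
      (R n * (2 * critSV s (wordProd T p.1))) with ht
  have hcpos : ∀ n (w : Fin n → Fin m), 0 < critSV s (wordProd T w) := fun n w =>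
    critSV_pos hs0 hs (isUnit_wordProd hTu w)
  have hcle : ∀ n (w : Fin n → Fin m), critSV s (wordProd T w) ≤ L ^ n := fun n w =>
    (singVal_le_norm _ (ceil_sub_one_lt hs0 hs)).trans (norm_wordProd_le hL0.le hL w)
  have hdiam : ∀ n p, Metric.ediam (t n p) ≤
      ENNReal.ofReal (4 * R n * critSV s (wordProd T p.1)) := by
    intro n p
    refine Metric.ediam_le fun x hx z hz => ?_
    rw [edist_dist]
    refine ENNReal.ofReal_le_ofReal ((dist_triangle_right _ _
      (perturbedComp T a y (e n p.1) n 0 + R n • (p.2 : Space d))).trans ?_)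
    have := add_le_add (Metric.mem_closedBall.1 hx) (Metric.mem_closedBall.1 hz)
    linarith
  have hcover : ∀ n, attractor T a y ⊆ ⋃ p, t n p := by
    rintro n _ ⟨i, rfl⟩
    set w : Fin n → Fin m := fun k => i k
    obtain ⟨z, hz, hzeq⟩ := h.exists_codingMap_eq hL0.le hτ.le hL hLτ i n
    have hz' : ‖(R n)⁻¹ • z‖ ≤ 1 := by
      rw [norm_smul, norm_inv, Real.norm_of_nonneg (hRpos n).le, inv_mul_le_iff₀ (hRpos n), mul_one]
      exact hz
    obtain ⟨p, hp, hpz⟩ := hF2 n w _ hz'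
    refine Set.mem_iUnion.2 ⟨⟨w, p, hp⟩, ?_⟩
    have hpc : perturbedComp T a y i n 0 = perturbedComp T a y (e n w) n 0 :=
      perturbedComp_congr T a y fun k hk => by simp [he, hk, w]
    simp only [ht, Metric.mem_closedBall, dist_eq_norm]
    rw [hzeq, hpc, add_sub_add_left_eq_sub]
    have : prefixProd T i n z - R n • p = R n • (wordProd T w ((R n)⁻¹ • z) - p) := by
      rw [smul_sub, ← map_smul, smul_inv_smul₀ (hRpos n).ne']
      rfl
    rw [this, norm_smul, Real.norm_of_nonneg (hRpos n).le]
    exact mul_le_mul_of_nonneg_left hpz (hRpos n).le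
  have hRL : ∀ n, R n * L ^ n = C / (1 - L * τ) * (L * τ) ^ n := fun n => by
    rw [hR, mul_pow]; ring
  have hr : Tendsto (fun n => ENNReal.ofReal (4 * (C / (1 - L * τ)) * (L * τ) ^ n)) atTop (𝓝 0) := by
    rw [← ENNReal.ofReal_zero]
    refine ENNReal.tendsto_ofReal ?_
    simpa using (tendsto_pow_atTop_nhds_zero_of_lt_one (by positivity) hLτ).const_mul
      (4 * (C / (1 - L * τ)))
  set B : ℝ := (4 * (C / (1 - L * τ))) ^ (s : ℝ) * K *
    ∑' n : ℕ, ∑ w : Fin n → Fin m, singularValueFunction s₀ (wordProd T w) with hB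
  have hfin : μH[s] (attractor T a y) ≤ ENNReal.ofReal B := by
    refine (Measure.hausdorffMeasure_le_liminf_sum (s : ℝ) (attractor T a y) _ hr t
      (Eventually.of_forall fun n p => (hdiam n p).trans (ENNReal.ofReal_le_ofReal ?_))
      (Eventually.of_forall hcover)).trans ?_
    · rw [mul_assoc 4 (C / _), ← hRL, mul_assoc]
      have := mul_le_mul_of_nonneg_left (hcle n p.1) (hRpos n).le
      linarith
    · refine liminf_le_of_le (by isBoundedDefault) fun b hb => ?_
      obtain ⟨n, hn⟩ := hb.exists
      refine hn.trans ?_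
      have h1 : ∀ p, Metric.ediam (t n p) ^ (s : ℝ) ≤
          ENNReal.ofReal ((4 * R n) ^ (s : ℝ) * critSV s (wordProd T p.1) ^ (s : ℝ)) := by
        intro p
        rw [← Real.mul_rpow (by have := hRpos n; positivity) (hcpos n _).le,
          ← ENNReal.ofReal_rpow_of_nonneg _ hs0.le]
        · exact ENNReal.rpow_le_rpow (hdiam n p) hs0.le
        · have := hRpos n; have := hcpos n p.1; positivity
      refine (Finset.sum_le_sum fun p _ => h1 p).trans ?_
      rw [Fintype.sum_sigma]
      simp only [Finset.sum_const, Finset.card_univ, Fintype.card_coe, nsmul_eq_mul]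
      have h2 : ∀ w : Fin n → Fin m, ((F n w).card : ℝ≥0∞) *
          ENNReal.ofReal ((4 * R n) ^ (s : ℝ) * critSV s (wordProd T w) ^ (s : ℝ)) ≤
          ENNReal.ofReal ((4 * (C / (1 - L * τ))) ^ (s : ℝ) * K *
            singularValueFunction s₀ (wordProd T w)) := by
        intro w
        rw [← ENNReal.ofReal_natCast, ← ENNReal.ofReal_mul (by positivity)]
        refine ENNReal.ofReal_le_ofReal ?_
        have hφ0 := singularValueFunction_nonneg hs₀ (wordProd T w)
        have e1 : (4 * R n) ^ (s : ℝ) =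
            (4 * (C / (1 - L * τ))) ^ (s : ℝ) * (τ ^ (s : ℝ)) ^ n := by
          rw [hR, ← mul_assoc, Real.mul_rpow (by positivity) (by positivity),
            ← Real.rpow_natCast, ← Real.rpow_natCast, ← Real.rpow_mul hτ.le,
            ← Real.rpow_mul hτ.le, mul_comm (n : ℝ)]
        calc ((F n w).card : ℝ) * ((4 * R n) ^ (s : ℝ) * critSV s (wordProd T w) ^ (s : ℝ))
            = (4 * R n) ^ (s : ℝ) * ((F n w).card * critSV s (wordProd T w) ^ (s : ℝ)) := by ring
          _ ≤ (4 * R n) ^ (s : ℝ) * (K * ((L ^ (s - s₀)) ^ n *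
                singularValueFunction s₀ (wordProd T w))) := by
              have := hRpos n
              refine mul_le_mul_of_nonneg_left ((hF1 n w).trans ?_) (by positivity)
              exact mul_le_mul_of_nonneg_left
                (singularValueFunction_wordProd_le_mul hd hTu hL0.le hL hs₀ hs₀s.le w) hK.le
          _ = (4 * (C / (1 - L * τ))) ^ (s : ℝ) * K * singularValueFunction s₀ (wordProd T w) *
                (τ ^ (s : ℝ) * L ^ (s - s₀)) ^ n := by rw [e1, mul_pow]; ring
          _ ≤ _ := mul_le_of_le_one_right (by positivity) (pow_le_one₀ (by positivity) hτs)
      refine (Finset.sum_le_sum fun w _ => h2 w).trans ?_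
      rw [← ENNReal.ofReal_sum_of_nonneg fun w _ => by
        have := singularValueFunction_nonneg hs₀ (wordProd T w); positivity]
      refine ENNReal.ofReal_le_ofReal ?_
      rw [← Finset.mul_sum, hB]
      refine mul_le_mul_of_nonneg_left ?_ (by positivity)
      exact hsum.le_tsum n fun k _ =>
        Finset.sum_nonneg fun w _ => singularValueFunction_nonneg hs₀ _
  exact dimH_le_of_hausdorffMeasure_ne_top (hfin.trans_lt ENNReal.ofReal_lt_top).ne

theorem exists_summable_of_affinityDim_lt {d m : ℕ} {T : Fin m → Space d →L[ℝ] Space d} {s : ℝ}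
    (h : affinityDim T < ENNReal.ofReal s) : ∃ s₀, 0 < s₀ ∧ s₀ < s ∧
      Summable fun n : ℕ => ∑ w : Fin n → Fin m, singularValueFunction s₀ (wordProd T w) := by
  unfold affinityDim at h
  simp only [iInf_lt_iff] at h
  obtain ⟨s₀, hs₀, hlt⟩ := h
  obtain ⟨h0, hsum⟩ := hs₀
  exact ⟨s₀, h0, (ENNReal.ofReal_lt_ofReal_iff'.1 hlt).1, hsum⟩

theorem not_summable_of_lt_affinityDim {d m : ℕ} {T : Fin m → Space d →L[ℝ] Space d} {s : ℝ}
    (hs : 0 < s) (h : ENNReal.ofReal s < affinityDim T) :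
    ¬ Summable fun n : ℕ => ∑ w : Fin n → Fin m, singularValueFunction s (wordProd T w) :=
  fun hsum => (biInf_le ENNReal.ofReal (show s ∈ {s : ℝ | 0 < s ∧ Summable fun n : ℕ =>
    ∑ w : Fin n → Fin m, singularValueFunction s (wordProd T w)} from ⟨hs, hsum⟩)).not_gt h

theorem ae_dimH_attractor_le {d m : ℕ} (hd : 1 ≤ d) (hm : 1 ≤ m)
    {T : Fin m → Space d →L[ℝ] Space d} (hTu : ∀ i, IsUnit (T i)) (hT : ∀ i, ‖T i‖ < 1)
    (a : Fin m → Space d) (η : Measure (Space d)) [IsProbabilityMeasure η]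
    (hη : HasSuperpolynomialDecay η) :
    ∀ᵐ y ∂(perturbationLaw m η), dimH (attractor T a y) ≤ affinityDim T := by
  obtain ⟨L, hL0, hL1, hL⟩ := exists_norm_le_lt_one hT
  have key : ∀ s : ℝ≥0, affinityDim T < s → (s : ℝ) ≤ d →
      ∀ᵐ y ∂(perturbationLaw m η), dimH (attractor T a y) ≤ s := by
    intro s hs hsd
    rw [← ENNReal.ofReal_coe_nnreal] at hs
    obtain ⟨s₀, hs₀, hs₀s, hsum⟩ := exists_summable_of_affinityDim_lt hs
    have hs0 : (0 : ℝ) < s := hs₀.trans hs₀s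
    -- the largest growth rate for which the covering sums stay bounded
    set τ : ℝ := L ^ (-((s - s₀) / s)) with hτ
    have hτ1 : 1 < τ := Real.one_lt_rpow_of_pos_of_lt_one_of_neg hL0 hL1
      (neg_lt_zero.2 (div_pos (sub_pos.2 hs₀s) hs0))
    have hLτ : L * τ < 1 := by
      rw [hτ, ← Real.rpow_one_add' hL0.le]
      · refine Real.rpow_lt_one hL0.le hL1 ?_
        have : 1 + -((s - s₀) / s) = s₀ / s := by field_simp; ring
        rw [this]
        positivity
      · have : 1 + -((s - s₀) / s) = s₀ / s := by field_simp; ring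
        rw [this]
        positivity
    have hτs : τ ^ (s : ℝ) * L ^ (s - s₀) ≤ 1 := by
      rw [hτ, ← Real.rpow_mul hL0.le, ← Real.rpow_add hL0]
      have : -((s - s₀) / s) * s + (s - s₀) = 0 := by field_simp; ring
      rw [this, Real.rpow_zero]
    filter_upwards [ae_exists_growthBound hm a η hη hτ1] with y ⟨C, hC, hy⟩
    exact hy.dimH_attractor_le hd hm hTu hC hL0 (zero_lt_one.trans hτ1) hL hLτ hs₀ hs₀s hsd
      hτs hsum
  rcases le_or_gt (d : ℝ≥0∞) (affinityDim T) with hle | hlt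
  · refine Eventually.of_forall fun y => le_trans ?_ hle
    refine (dimH_mono (Set.subset_univ _)).trans ?_
    rw [Real.dimH_univ_eq_finrank, finrank_euclideanSpace_fin]
  · obtain ⟨u, -, hu, hulim⟩ := exists_seq_strictAnti_tendsto' hlt
    have hall : ∀ᵐ y ∂(perturbationLaw m η), ∀ n, dimH (attractor T a y) ≤ u n := by
      rw [ae_all_iff]
      intro n
      have hun := hu n
      lift u n to ℝ≥0 using (hun.2.trans_le le_top).ne with s
      refine key s hun.1 ?_
      exact_mod_cast hun.2.le
    filter_upwards [hall] with y hy
    exact ge_of_tendsto' hulim hy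

/-! ### Transversality -/

/-- The part of `{‖A z + c‖ ≤ r}` in the ball of radius `R` lies in a translate of a slab, the rest is
in the tail of `η`. -/
theorem exists_measure_le_add_tail {d : ℕ} (hd : 1 ≤ d) {η : Measure (Space d)}
    (hη : HasBoundedDensity η) {s : ℝ} (hs0 : 0 < s) (hs : s ≤ d) :
    ∃ K : ℝ, 0 < K ∧ ∀ A : Space d →L[ℝ] Space d, IsUnit A → ∀ (c : Space d) (r R : ℝ),
      0 < r → 0 < R → η {z | ‖A z + c‖ ≤ r} ≤
        ENNReal.ofReal (K * (R ^ (d - s) * r ^ s / singularValueFunction s A)) +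
          η {z | R < ‖z‖} := by
  obtain ⟨f, hf, ⟨K, hK⟩, rfl⟩ := hη
  have hle : ∀ S, volume.withDensity f S ≤ K * volume S := by
    intro S
    have h1 : volume.withDensity f ≤ volume.withDensity fun _ => (K : ℝ≥0∞) :=
      withDensity_mono (Eventually.of_forall hK)
    refine (h1 S).trans (le_of_eq ?_)
    rw [withDensity_const]
    rfl
  -- `K + 1` instead of `K`, so that the constant is positive
  refine ⟨(K + 1) * (2 ^ d * (2 ^ (d - s) * 2 ^ s)), by positivity, fun A hA c r R hr hR => ?_⟩
  have hsub : {z | ‖A z + c‖ ≤ r} ⊆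
      {z | ‖z‖ ≤ R ∧ ‖A z + c‖ ≤ r} ∪ {z | R < ‖z‖} := by
    intro z hz
    rcases le_or_gt ‖z‖ R with h | h
    · exact Or.inl ⟨h, hz⟩
    · exact Or.inr h
  refine (measure_mono hsub).trans ((measure_union_le _ _).trans (add_le_add_left ?_ _))
  have hvol : volume {z | ‖z‖ ≤ R ∧ ‖A z + c‖ ≤ r} ≤ volume (slab A (2 * R) (2 * r)) := by
    rcases Set.eq_empty_or_nonempty {z | ‖z‖ ≤ R ∧ ‖A z + c‖ ≤ r} with h | ⟨z₀, hz₀, hz₀'⟩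
    · rw [h, measure_empty]
      exact zero_le
    · rw [← (measurePreserving_sub_right volume z₀).measure_preimage
        (isClosed_slab A _ _).measurableSet.nullMeasurableSet]
      refine measure_mono fun z hz => ⟨?_, ?_⟩
      · exact (norm_sub_le _ _).trans (by linarith [hz.1])
      · have e : A (z - z₀) = (A z + c) - (A z₀ + c) := by rw [map_sub]; abel
        rw [e]
        exact (norm_sub_le _ _).trans (by linarith [hz.2])
  have hφ := singularValueFunction_pos hs0 hA
  calc _ ≤ (K : ℝ≥0∞) * volume (slab A (2 * R) (2 * r)) :=
        (hle _).trans (mul_le_mul_right hvol _)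
    _ ≤ K * ENNReal.ofReal (2 ^ d * ((2 * R) ^ (d - s) * (2 * r) ^ s /
          singularValueFunction s A)) :=
        mul_le_mul_right (volume_slab_le hd hs0 hs (by positivity) (by positivity) hA) _
    _ ≤ _ := by
        rw [← ENNReal.ofReal_coe_nnreal, ← ENNReal.ofReal_mul (by positivity)]
        refine ENNReal.ofReal_le_ofReal ?_
        rw [Real.mul_rpow zero_le_two hR.le, Real.mul_rpow zero_le_two hr.le]
        have : (K : ℝ) * (2 ^ d * (2 ^ (d - s) * R ^ (d - s) * (2 ^ s * r ^ s) /
            singularValueFunction s A)) = K * (2 ^ d * (2 ^ (d - s) * 2 ^ s)) *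
            (R ^ (d - s) * r ^ s / singularValueFunction s A) := by ring
        rw [this]
        gcongr
        linarith

/-- The self-affine transversality estimate for a single perturbation. Truncating `η` at a radius
`R` costs a factor `R ^ (d - s)`; for `q < s` the choice `R = r ^ (-δ)` with small `δ` is
compensated by the difference of exponents, and for `s = d` there is no cost. -/
theorem exists_measure_norm_le {d : ℕ} (hd : 1 ≤ d) {η : Measure (Space d)}
    [IsProbabilityMeasure η] (hη : HasBoundedDensity η) (hη' : HasSuperpolynomialDecay η) {s q : ℝ}
    (hs0 : 0 < s) (hs : s ≤ d) (hq0 : 0 < q) (hqs : q < s ∨ q = s ∧ s = d) :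
    ∃ C : ℝ, 0 < C ∧ ∀ A : Space d →L[ℝ] Space d, IsUnit A → ‖A‖ ≤ 1 → ∀ (c : Space d) (r : ℝ),
      0 < r → r ≤ 1 → η {z | ‖A z + c‖ ≤ r} ≤
        ENNReal.ofReal (C * r ^ q / singularValueFunction s A) := by
  obtain ⟨K, hK, hmain⟩ := exists_measure_le_add_tail hd hη hs0 hs
  have htail : ∀ k : ℕ, ∃ c : ℝ, 0 < c ∧ ∀ R : ℝ, 0 < R →
      η {z | R < ‖z‖} ≤ ENNReal.ofReal (c / R ^ k) := by
    intro k
    obtain ⟨c, hc⟩ := hη' k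
    refine ⟨|c| + 1, by positivity, fun R hR => ?_⟩
    rw [ENNReal.le_ofReal_iff_toReal_le (measure_ne_top _ _) (by positivity)]
    refine (hc R hR).trans ?_
    gcongr
    linarith [le_abs_self c]
  have hd' : (0 : ℝ) < d := by exact_mod_cast hd
  rcases hqs with hqs | ⟨rfl, rfl⟩
  · set δ : ℝ := (s - q) / d with hδ
    have hδ0 : 0 < δ := div_pos (sub_pos.2 hqs) hd'
    obtain ⟨k, hk⟩ := exists_nat_ge (q / δ)
    -- `k ≥ q / δ` makes the tail `R ^ (-k)` at most `r ^ q`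
    obtain ⟨c₀, hc₀, htail⟩ := htail k
    refine ⟨K + c₀, by positivity, fun A hA hA1 c r hr0 hr1 => ?_⟩
    have hφ := singularValueFunction_pos hs0 hA
    have hφ1 := singularValueFunction_le_one hs0 hA1
    have hR : 0 < r ^ (-δ) := by positivity
    refine (hmain A hA c r _ hr0 hR).trans ((add_le_add_right (htail _ hR) _).trans ?_)
    rw [← ENNReal.ofReal_add (by positivity) (by positivity)]
    refine ENNReal.ofReal_le_ofReal ?_
    have h1 : (r ^ (-δ)) ^ ((d : ℝ) - s) * r ^ s ≤ r ^ q := by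
      rw [← Real.rpow_mul hr0.le, ← Real.rpow_add hr0]
      refine Real.rpow_le_rpow_of_exponent_ge hr0 hr1 ?_
      have : δ * d = s - q := by rw [hδ]; field_simp
      nlinarith
    have h2 : c₀ / (r ^ (-δ)) ^ k ≤ c₀ * r ^ q / singularValueFunction s A := by
      rw [← Real.rpow_natCast, ← Real.rpow_mul hr0.le, neg_mul, Real.rpow_neg hr0.le, div_inv_eq_mul]
      rw [le_div_iff₀ hφ]
      refine (mul_le_of_le_one_right (by positivity) hφ1).trans ?_
      gcongr ?_ * ?_
      refine Real.rpow_le_rpow_of_exponent_ge hr0 hr1 ?_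
      rwa [div_le_iff₀ hδ0, mul_comm] at hk
    calc _ ≤ K * (r ^ q / singularValueFunction s A) + c₀ * r ^ q / singularValueFunction s A := by
          gcongr
      _ = _ := by ring
  · -- the bound for the truncated part does not involve `R`, so `R` is taken so large that the
    -- tail is at most the desired bound
    obtain ⟨c₀, hc₀, htail⟩ := htail 1
    refine ⟨K + 1, by positivity, fun A hA hA1 c r hr0 hr1 => ?_⟩
    have hφ := singularValueFunction_pos hs0 hA
    set X := r ^ (d : ℝ) / singularValueFunction d A with hX
    have hX0 : 0 < X := by positivity
    refine (hmain A hA c r (c₀ / X) hr0 (by positivity)).trans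
      ((add_le_add_right (htail (c₀ / X) (by positivity)) _).trans ?_)
    rw [← ENNReal.ofReal_add (by positivity) (by positivity)]
    refine ENNReal.ofReal_le_ofReal (le_of_eq ?_)
    rw [sub_self, Real.rpow_zero, one_mul, pow_one, div_div_cancel₀ hc₀.ne', mul_div_assoc, ← hX]
    ring

theorem measurable_update_prod {ι X : Type*} [DecidableEq ι] [MeasurableSpace X] (u : ι) :
    Measurable fun p : (ι → X) × X => Function.update p.1 u p.2 := by
  refine measurable_pi_lambda _ fun i => ?_
  by_cases hi : i = u
  · subst hi
    simp only [Function.update_self]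
    exact measurable_snd
  · simp only [Function.update_of_ne hi]
    exact (measurable_pi_apply i).comp measurable_fst

/-- Resampling one coordinate of an independent family does not change its law. -/
theorem map_update_infinitePi {ι X : Type*} [DecidableEq ι] [MeasurableSpace X]
    (η : Measure X) [IsProbabilityMeasure η] (u : ι) :
    ((Measure.infinitePi fun _ : ι => η).prod η).map (fun p => Function.update p.1 u p.2) =
      Measure.infinitePi fun _ : ι => η := by
  refine Measure.eq_infinitePi _ fun s t ht => ?_
  rw [Measure.map_apply (measurable_update_prod u) (MeasurableSet.pi s.countable_toSet fun i _ => ht i)]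
  by_cases hu : u ∈ s
  · have : (fun p : (ι → X) × X => Function.update p.1 u p.2) ⁻¹' Set.pi s t =
        Set.pi (s.erase u : Finset ι) t ×ˢ t u := by
      ext ⟨y, z⟩
      simp only [Set.mem_preimage, Set.mem_pi, Finset.mem_coe, Set.mem_prod, Finset.mem_erase]
      constructor
      · intro h
        refine ⟨fun i hi => ?_, by simpa using h u hu⟩
        simpa [Function.update_of_ne hi.1] using h i hi.2
      · rintro ⟨h1, h2⟩ i hi
        by_cases hiu : i = u
        · subst hiu
          simpa using h2
        · simpa [Function.update_of_ne hiu] using h1 i ⟨hiu, hi⟩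
    rw [this, Measure.prod_prod, Measure.infinitePi_pi _ fun i _ => ht i,
      Finset.prod_erase_mul _ _ hu]
  · have : (fun p : (ι → X) × X => Function.update p.1 u p.2) ⁻¹' Set.pi s t =
        Set.pi s t ×ˢ Set.univ := by
      ext ⟨y, z⟩
      simp only [Set.mem_preimage, Set.mem_pi, Finset.mem_coe, Set.mem_prod, Set.mem_univ, and_true]
      refine forall₂_congr fun i hi => ?_
      rw [Function.update_of_ne (ne_of_mem_of_not_mem hi hu)]
    rw [this, Measure.prod_prod, Measure.infinitePi_pi _ fun i _ => ht i, measure_univ, mul_one]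

/-- The `k`-th term of the series for `Π(i)`, as a function of the initial segment of `i`. -/
noncomputable def codingTerm {d m : ℕ} (T : Fin m → Space d →L[ℝ] Space d)
    (a : Fin m → Space d) (y : Word m → Space d) {k : ℕ} (w : Fin (k + 1) → Fin m) : Space d :=
  wordProd T (fun l : Fin k => w l.castSucc) (a (w (Fin.last k)) + y ⟨k, w⟩)

theorem perturbedComp_eq_sum_codingTerm {d m : ℕ} (T : Fin m → Space d →L[ℝ] Space d)
    (a : Fin m → Space d) (y : Word m → Space d) (i : ℕ → Fin m) (n : ℕ) :
    perturbedComp T a y i n 0 =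
      ∑ k ∈ Finset.range n, codingTerm T a y fun l : Fin (k + 1) => i l := by
  rw [perturbedComp_zero_apply]
  rfl

theorem measurable_perturbedComp {d m : ℕ} (T : Fin m → Space d →L[ℝ] Space d)
    (a : Fin m → Space d) (n : ℕ) :
    Measurable fun p : (Word m → Space d) × (ℕ → Fin m) => perturbedComp T a p.1 p.2 n 0 := by
  simp_rw [perturbedComp_eq_sum_codingTerm]
  refine Finset.measurable_sum _ fun k _ => ?_
  have h1 : Measurable fun q : (Word m → Space d) × (Fin (k + 1) → Fin m) =>
      codingTerm T a q.1 q.2 := by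
    refine measurable_from_prod_countable_left fun w => ?_
    have h : Measurable fun y : Word m → Space d => a (w (Fin.last k)) + y ⟨k, w⟩ :=
      (measurable_pi_apply (⟨k, w⟩ : Word m)).const_add _
    exact (wordProd T _).measurable.comp h
  have h2 : Measurable fun p : (Word m → Space d) × (ℕ → Fin m) =>
      (p.1, fun l : Fin (k + 1) => p.2 l) :=
    measurable_fst.prodMk (measurable_pi_lambda _ fun l =>
      (measurable_pi_apply _).comp measurable_snd)
  exact h1.comp h2

theorem measurable_codingMap {d m : ℕ} (T : Fin m → Space d →L[ℝ] Space d)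
    (a : Fin m → Space d) :
    Measurable fun p : (Word m → Space d) × (ℕ → Fin m) => codingMap T a p.1 p.2 :=
  (StronglyMeasurable.limUnder (l := atTop) (f := fun r p => perturbedComp T a
    (Prod.fst p : Word m → Space d) (Prod.snd p : ℕ → Fin m) (r + 1) 0)
    fun r => (measurable_perturbedComp T a (r + 1)).stronglyMeasurable).measurable

theorem GrowthBound.continuous_codingMap {d m : ℕ} {T : Fin m → Space d →L[ℝ] Space d}
    {a : Fin m → Space d} {y : Word m → Space d} {C τ L : ℝ} (hL0 : 0 ≤ L) (hτ : 0 ≤ τ)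
    (hL : ∀ i, ‖T i‖ ≤ L) (hLτ : L * τ < 1) (h : GrowthBound a y C τ) :
    Continuous (codingMap T a y) := by
  have hs : ∀ i : ℕ → Fin m, Summable fun k => codingTerm T a y fun l : Fin (k + 1) => i l := fun i =>
    Summable.of_norm_bounded ((summable_geometric_of_lt_one (by positivity) hLτ).mul_left C)
      (h.norm_term_le hL0 hL i)
  have heq : codingMap T a y = fun i => ∑' k, codingTerm T a y fun l : Fin (k + 1) => i l := by
    funext i
    refine tendsto_nhds_unique ((h.isWellDefined hL0 hτ hL hLτ).tendsto_codingMap i) ?_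
    simp_rw [perturbedComp_eq_sum_codingTerm]
    exact (hs i).hasSum.tendsto_sum_nat
  rw [heq]
  refine continuous_tsum (fun k => ?_)
    ((summable_geometric_of_lt_one (by positivity) hLτ).mul_left C)
    fun k i => h.norm_term_le hL0 hL i k
  have h1 : Continuous fun w : Fin (k + 1) → Fin m => codingTerm T a y w :=
    continuous_of_discreteTopology
  have h2 : Continuous fun (i : ℕ → Fin m) (l : Fin (k + 1)) => i l :=
    continuous_pi fun l => continuous_apply (l : ℕ)
  exact h1.comp h2

/-- Two words that separate after their common prefix `w` are coded within distance `r` with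
probability at most of order `r ^ q / φ^s(T_w)`. -/
theorem measure_norm_codingMap_sub_le {d m : ℕ} (hm : 1 ≤ m)
    {T : Fin m → Space d →L[ℝ] Space d} (hT : ∀ i, ‖T i‖ < 1)
    (a : Fin m → Space d) (η : Measure (Space d)) [IsProbabilityMeasure η]
    (hη' : HasSuperpolynomialDecay η) {i j : ℕ → Fin m} {n : ℕ} (hij : i n ≠ j n) {r : ℝ}
    {b : ℝ≥0∞} (hb : ∀ c : Space d, η {z | ‖prefixProd T i n z + c‖ ≤ r} ≤ b) :
    (perturbationLaw m η) {y | ‖codingMap T a y i - codingMap T a y j‖ ≤ r} ≤ b := by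
  classical
  have hmi : ∀ i, Measurable fun y : Word m → Space d => codingMap T a y i := by
    intro i
    have h := (measurable_codingMap T a).comp
      (measurable_prodMk_right (y := i) : Measurable fun y : Word m → Space d => (y, i))
    exact h
  set E := {y : Word m → Space d | ‖codingMap T a y i - codingMap T a y j‖ ≤ r} with hE
  have hEm : MeasurableSet E := measurableSet_le ((hmi i).sub (hmi j)).norm measurable_const
  set u := restrict i n
  have hupd := measurable_update_prod (X := Space d) u
  have hlaw : (perturbationLaw m η) E =
      ∫⁻ y, η {z | Function.update y u z ∈ E} ∂(perturbationLaw m η) := by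
    conv_lhs => rw [perturbationLaw, ← map_update_infinitePi η u]
    rw [Measure.map_apply hupd hEm, Measure.prod_apply (hupd hEm)]
    rfl
  have : IsProbabilityMeasure (perturbationLaw m η) := by
    unfold perturbationLaw; infer_instance
  rw [hlaw]
  calc _ ≤ ∫⁻ _, b ∂(perturbationLaw m η) := by
        refine lintegral_mono_ae ?_
        filter_upwards [ae_exists_growthBound_mul_lt_one hm hT a η hη'] with y ⟨C, τ, L, hC, hτ, hL0, hL, hLτ, hy⟩
        have hw := hy.isWellDefined hL0.le (zero_le_one.trans hτ.le) hL hLτ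
        refine le_trans (le_of_eq ?_) (hb (codingMap T a y i - codingMap T a y j -
          prefixProd T i n (y (restrict i n))))
        congr 1
        ext z
        simp only [hE, Set.mem_ofPred_eq]
        rw [hw.codingMap_update_sub hij z]
    _ = b := by simp

/-! ### Lower bounds from pair correlations -/

/-- The potential-theoretic lower bound for the Hausdorff dimension of the support of a measure,
with the energy written as a sum over dyadic scales. -/
theorem le_dimH_range_of_energy {Ω X : Type*} [MeasurableSpace Ω] [MetricSpace X]
    [MeasurableSpace X] [BorelSpace X] [SecondCountableTopology X] (μ : Measure Ω)
    [IsProbabilityMeasure μ] {f : Ω → X}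
    (hf : Measurable f) {t : ℝ≥0} (ht : 0 < t)
    (h : ∫⁻ i, ∑' k : ℕ, ENNReal.ofReal ((2 ^ (t : ℝ)) ^ k) *
      μ {j | dist (f i) (f j) ≤ (1 / 2) ^ k} ∂μ ≠ ∞) : (t : ℝ≥0∞) ≤ dimH (Set.range f) := by
  set a : ℝ := 2 ^ (t : ℝ) with ha
  have ha0 : 0 < a := by positivity
  set p : Ω → ℝ≥0∞ := fun i => ∑' k : ℕ, ENNReal.ofReal (a ^ k) *
      μ {j | dist (f i) (f j) ≤ (1 / 2) ^ k} with hp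
  have hpm : Measurable p := by
    refine Measurable.tsum fun k => Measurable.const_mul ?_ _
    have hS : MeasurableSet {q : Ω × Ω | dist (f q.1) (f q.2) ≤ (1 / 2) ^ k} :=
      measurableSet_le ((hf.comp measurable_fst).dist (hf.comp measurable_snd)) measurable_const
    exact measurable_measure_prodMk_left hS
  have hfin : ∀ᵐ i ∂μ, p i < ∞ := ae_lt_top hpm h
  obtain ⟨N, hN⟩ : ∃ N : ℕ, 0 < μ {i | p i ≤ N} := by
    by_contra! hcon
    have h0 : μ (⋃ N : ℕ, {i | p i ≤ N}) = 0 :=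
      measure_iUnion_null fun N => nonpos_iff_eq_zero.1 (hcon N)
    have h1 : ∀ᵐ i ∂μ, i ∉ ⋃ N : ℕ, {i | p i ≤ N} := measure_eq_zero_iff_ae_notMem.1 h0
    obtain ⟨i, hi1, hi2⟩ := (hfin.and h1).exists
    obtain ⟨N, hN⟩ := ENNReal.exists_nat_gt hi1.ne
    exact hi2 (Set.mem_iUnion.2 ⟨N, hN.le⟩)
  set A := {i | p i ≤ N} with hA
  have hAm : MeasurableSet A := measurableSet_le hpm measurable_const
  set ν := (μ.restrict A).map f with hν
  -- balls around points of `A` have small mass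
  have hball : ∀ i ∈ A, ∀ k : ℕ, μ {j | dist (f i) (f j) ≤ (1 / 2) ^ k} ≤
      ENNReal.ofReal (N * (a⁻¹) ^ k) := by
    intro i hi k
    have h1 : ENNReal.ofReal (a ^ k) * μ {j | dist (f i) (f j) ≤ (1 / 2) ^ k} ≤ N :=
      (ENNReal.le_tsum k).trans hi
    rw [mul_comm, ← ENNReal.le_div_iff_mul_le
      (Or.inl (ENNReal.ofReal_pos.2 (by positivity)).ne') (Or.inl ENNReal.ofReal_ne_top)] at h1
    refine h1.trans (le_of_eq ?_)
    rw [← ENNReal.ofReal_natCast, ← ENNReal.ofReal_div_of_pos (by positivity), inv_pow,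
      div_eq_mul_inv]
  -- the `+ 1` keeps the constant positive when `N = 0`
  set c : ℝ := N * a + 1 with hc
  have hc0 : 0 < c := by positivity
  have hset : ∀ S : Set X, Metric.ediam S ≤ 1 → ν S ≤ ENNReal.ofReal c * Metric.ediam S ^ (t : ℝ) := by
    intro S hS
    refine (measure_mono subset_closure).trans ?_
    rw [hν, Measure.map_apply hf isClosed_closure.measurableSet,
      Measure.restrict_apply (hf isClosed_closure.measurableSet)]
    rcases Set.eq_empty_or_nonempty (f ⁻¹' closure S ∩ A) with he | ⟨i, hi1, hi2⟩
    · rw [he, measure_empty]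
      exact zero_le
    set δ := (Metric.ediam S).toReal with hδ
    have hSfin : Metric.ediam S ≠ ∞ := (hS.trans_lt ENNReal.one_lt_top).ne
    have hδ1 : δ ≤ 1 := ENNReal.toReal_le_of_le_ofReal zero_le_one (by simpa using hS)
    have hsub : f ⁻¹' closure S ∩ A ⊆ {j | dist (f i) (f j) ≤ δ} := by
      rintro j ⟨hj, -⟩
      have h1 : edist (f i) (f j) ≤ Metric.ediam S := by
        rw [← Metric.ediam_closure]
        exact Metric.edist_le_ediam_of_mem hi1 hj
      simp only [Set.mem_ofPred_eq]
      rw [dist_edist]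
      exact ENNReal.toReal_mono hSfin h1
    refine (measure_mono hsub).trans ?_
    have hδ0 : 0 ≤ δ := ENNReal.toReal_nonneg
    rcases hδ0.eq_or_lt with h0 | hpos
    · have hlim : Tendsto (fun k : ℕ => ENNReal.ofReal (N * (a⁻¹) ^ k)) atTop (𝓝 0) := by
        rw [← ENNReal.ofReal_zero]
        refine ENNReal.tendsto_ofReal ?_
        have : a⁻¹ < 1 := inv_lt_one_of_one_lt₀ (Real.one_lt_rpow one_lt_two ht)
        simpa using (tendsto_pow_atTop_nhds_zero_of_lt_one (by positivity) this).const_mul (N : ℝ)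
      refine le_trans (ge_of_tendsto' hlim fun k => le_trans (measure_mono ?_) (hball i hi2 k))
        zero_le
      intro j hj
      simp only [Set.mem_ofPred_eq] at hj ⊢
      rw [← h0] at hj
      exact hj.trans (by positivity)
    · obtain ⟨k, hk1, hk2⟩ := exists_nat_pow_near_of_lt_one hpos hδ1
        (by norm_num : (0 : ℝ) < 1 / 2) (by norm_num)
      refine (measure_mono fun j hj => le_trans hj hk2).trans ((hball i hi2 k).trans ?_)
      rw [← ENNReal.ofReal_toReal hSfin, ENNReal.ofReal_rpow_of_pos hpos,
        ← ENNReal.ofReal_mul hc0.le]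
      refine ENNReal.ofReal_le_ofReal ?_
      have h2 : (a⁻¹) ^ (k + 1) ≤ δ ^ (t : ℝ) := by
        have : (a⁻¹) ^ (k + 1) = ((1 / 2 : ℝ) ^ (k + 1)) ^ (t : ℝ) := by
          rw [ha, ← Real.inv_rpow zero_le_two, ← Real.rpow_natCast, ← Real.rpow_natCast,
            ← Real.rpow_mul (by norm_num), ← Real.rpow_mul (by norm_num), mul_comm (t : ℝ)]
          norm_num
        rw [this]
        exact Real.rpow_le_rpow (by positivity) hk1.le t.2
      calc N * (a⁻¹) ^ k = N * a * (a⁻¹) ^ (k + 1) := by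
            rw [pow_succ]; field_simp
        _ ≤ c * δ ^ (t : ℝ) := by
            gcongr
            simp [hc]
  have hν_le : (ENNReal.ofReal c)⁻¹ • ν ≤ μH[t] := by
    refine Measure.le_hausdorffMeasure _ _ 1 one_pos fun S hS => ?_
    rw [Measure.smul_apply, smul_eq_mul, ENNReal.inv_mul_le_iff
      (ENNReal.ofReal_pos.2 hc0).ne' ENNReal.ofReal_ne_top]
    exact hset S hS
  refine le_dimH_of_hausdorffMeasure_ne_zero (ne_of_gt ?_)
  refine lt_of_lt_of_le ?_ (hν_le (Set.range f))
  rw [Measure.smul_apply, smul_eq_mul]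
  refine ENNReal.mul_pos (ENNReal.inv_ne_zero.2 ENNReal.ofReal_ne_top) (ne_of_gt ?_)
  refine lt_of_lt_of_le ?_ (Measure.le_map_apply hf.aemeasurable _)
  simpa using hN

/-- If the pair correlations of the image measure under `f` are of order `r ^ d` along a sequence of
scales, then the neighbourhoods of the image have volume bounded below, by the Cauchy–Schwarz
inequality, and so does the image itself. -/
theorem volume_range_pos_of_pairs {Ω : Type*} [MeasurableSpace Ω] {d : ℕ} (μ : Measure Ω)
    [IsProbabilityMeasure μ] {f : Ω → Space d} (hf : Measurable f)
    (hcomp : IsCompact (Set.range f)) {M : ℝ≥0∞} (hM : M ≠ ∞)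
    (h : ∃ᶠ k : ℕ in atTop, (μ.prod μ) {p | dist (f p.1) (f p.2) ≤ (1 / 2) ^ k} ≤
      M * ENNReal.ofReal (((1 / 2) ^ k) ^ d)) : 0 < volume (Set.range f) := by
  set V := volume (Metric.closedBall (0 : Space d) 1) with hV
  have hV0 : V ≠ 0 := (Metric.measure_closedBall_pos volume _ one_pos).ne'
  have hVf : V ≠ ∞ := (isCompact_closedBall _ _).measure_lt_top.ne
  have hball : ∀ (x : Space d) {r : ℝ}, 0 ≤ r →
      volume (Metric.closedBall x r) = ENNReal.ofReal (r ^ d) * V := by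
    intro x r hr
    rw [Measure.addHaar_closedBall' _ _ hr, finrank_euclideanSpace_fin]
  have key : ∀ r : ℝ, 0 < r → ENNReal.ofReal (r ^ d) * V ≤
      volume (Metric.cthickening r (Set.range f)) *
        (μ.prod μ) {p | dist (f p.1) (f p.2) ≤ 2 * r} := by
    intro r hr
    set E := Metric.cthickening r (Set.range f) with hE
    have hEm : MeasurableSet E := Metric.isClosed_cthickening.measurableSet
    -- `g x` is the mass of the ball of radius `r` about `x` for the image measure: it vanishes outside
    -- `E`, has integral `I`, and its square integral is controlled by the pair correlations
    set g : Space d → ℝ≥0∞ := fun x => μ {i | dist (f i) x ≤ r} with hg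
    have hSm : MeasurableSet {q : Space d × Ω | dist (f q.2) q.1 ≤ r} :=
      measurableSet_le ((hf.comp measurable_snd).dist measurable_fst) measurable_const
    have hgm : Measurable g := measurable_measure_prodMk_left hSm
    set I := ENNReal.ofReal (r ^ d) * V with hI
    have hI0 : I ≠ 0 := mul_ne_zero (ENNReal.ofReal_pos.2 (by positivity)).ne' hV0
    have hIf : I ≠ ∞ := ENNReal.mul_ne_top ENNReal.ofReal_ne_top hVf
    have hint : ∫⁻ x, g x = I := by
      have h1 : (volume.prod μ) {q : Space d × Ω | dist (f q.2) q.1 ≤ r} = ∫⁻ x, g x :=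
        Measure.prod_apply hSm
      rw [← h1, Measure.prod_apply_symm hSm]
      have h2 : ∀ i : Ω, volume ((fun x => (x, i)) ⁻¹' {q : Space d × Ω | dist (f q.2) q.1 ≤ r})
          = I := by
        intro i
        rw [hI, ← hball (f i) hr.le]
        congr 1
        ext x
        simp [dist_comm]
      rw [lintegral_congr h2, lintegral_const, measure_univ, mul_one]
    have hsupp : ∀ x, g x * E.indicator 1 x = g x := by
      intro x
      by_cases hx : x ∈ E
      · simp [Set.indicator_of_mem hx]
      · have : {i | dist (f i) x ≤ r} = ∅ := by
          ext i
          simp only [Set.mem_ofPred_eq, Set.mem_empty_iff_false, iff_false, not_le]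
          by_contra! hle
          exact hx (Metric.mem_cthickening_of_dist_le x (f i) r _ ⟨i, rfl⟩ (by rwa [dist_comm]))
        simp [hg, this]
    have hsq : ∫⁻ x, g x ^ 2 ≤ (μ.prod μ) {p | dist (f p.1) (f p.2) ≤ 2 * r} * I := by
      set Q : Set (Space d × (Ω × Ω)) :=
        {q | dist (f q.2.1) q.1 ≤ r ∧ dist (f q.2.2) q.1 ≤ r} with hQ
      have hQm : MeasurableSet Q :=
        (measurableSet_le ((hf.comp (measurable_fst.comp measurable_snd)).dist measurable_fst)
          measurable_const).inter
        (measurableSet_le ((hf.comp (measurable_snd.comp measurable_snd)).dist measurable_fst)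
          measurable_const)
      have h1 : (volume.prod (μ.prod μ)) Q = ∫⁻ x, g x ^ 2 := by
        rw [Measure.prod_apply hQm]
        refine lintegral_congr fun x => ?_
        rw [sq, hg, ← Measure.prod_prod]
        rfl
      rw [← h1, Measure.prod_apply_symm hQm]
      have hPm : MeasurableSet {p : Ω × Ω | dist (f p.1) (f p.2) ≤ 2 * r} :=
        measurableSet_le ((hf.comp measurable_fst).dist (hf.comp measurable_snd)) measurable_const
      rw [mul_comm, ← setLIntegral_const, ← lintegral_indicator hPm]
      refine lintegral_mono fun p => ?_
      by_cases hp : p ∈ {p : Ω × Ω | dist (f p.1) (f p.2) ≤ 2 * r}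
      · rw [Set.indicator_of_mem hp, hI, ← hball (f p.1) hr.le]
        refine measure_mono fun x hx => ?_
        rw [Metric.mem_closedBall, dist_comm]
        exact hx.1
      · have : (fun x => (x, p)) ⁻¹' Q = ∅ := by
          ext x
          simp only [Set.mem_preimage, Set.mem_empty_iff_false, iff_false]
          rintro ⟨h1, h2⟩
          refine hp ((dist_triangle_right _ _ x).trans ?_)
          simp only at h1 h2
          linarith
        rw [this, measure_empty]
        exact zero_le
    have hCS : I ≤ (∫⁻ x, g x ^ (2 : ℝ)) ^ (1 / 2 : ℝ) * volume E ^ (1 / 2 : ℝ) := by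
      have h1 := ENNReal.lintegral_mul_le_Lp_mul_Lq volume Real.HolderConjugate.two_two
        hgm.aemeasurable (measurable_one.indicator hEm).aemeasurable (g := E.indicator 1)
      have h2 : ∫⁻ x, (g * E.indicator (1 : Space d → ℝ≥0∞)) x = I := by
        rw [← hint]
        exact lintegral_congr hsupp
      have h3 : ∫⁻ x, (E.indicator (1 : Space d → ℝ≥0∞) x) ^ (2 : ℝ) = volume E := by
        rw [← lintegral_indicator_one hEm]
        refine lintegral_congr fun x => ?_
        by_cases hx : x ∈ E
        · simp [Set.indicator_of_mem hx]
        · simp [Set.indicator_of_notMem hx]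
      rwa [h2, h3] at h1
    have hCS2 : I * I ≤ (∫⁻ x, g x ^ 2) * volume E := by
      clear_value I
      have h1 := mul_le_mul' hCS hCS
      have h2 : ∀ x : ℝ≥0∞, x ^ (1 / 2 : ℝ) * x ^ (1 / 2 : ℝ) = x := by
        intro x
        rw [← ENNReal.rpow_add_of_nonneg _ _ (by norm_num) (by norm_num)]
        norm_num
      rw [mul_mul_mul_comm, h2, h2] at h1
      simpa using h1
    have h3 := hCS2.trans (mul_le_mul_left hsq (volume E))
    have h4 : I * I ≤ volume E * (μ.prod μ) {p | dist (f p.1) (f p.2) ≤ 2 * r} * I := by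
      calc I * I ≤ _ := h3
        _ = _ := by ring
    exact (ENNReal.mul_le_mul_iff_left hI0 hIf).1 h4
  have hlow : ∃ᶠ k : ℕ in atTop, V ≤ volume (Metric.cthickening ((1 / 2) ^ k / 2) (Set.range f)) *
      (M * 2 ^ d) := by
    refine h.mono fun k hk => ?_
    have hr : (0 : ℝ) < (1 / 2) ^ k / 2 := by positivity
    have h1 := key _ hr
    rw [mul_div_cancel₀ _ (two_ne_zero' ℝ)] at h1
    have h2 := h1.trans (mul_le_mul_right hk _)
    set D := volume (Metric.cthickening ((1 / 2 : ℝ) ^ k / 2) (Set.range f))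
    have e : ENNReal.ofReal (((1 / 2 : ℝ) ^ k) ^ d) =
        2 ^ d * ENNReal.ofReal (((1 / 2 : ℝ) ^ k / 2) ^ d) := by
      have : ((1 / 2 : ℝ) ^ k) ^ d = 2 ^ d * ((1 / 2 : ℝ) ^ k / 2) ^ d := by
        rw [← mul_pow]; congr 1; ring
      rw [this, ENNReal.ofReal_mul (by positivity), ENNReal.ofReal_pow zero_le_two,
        ENNReal.ofReal_ofNat]
    rw [e] at h2
    have h3 : ENNReal.ofReal (((1 / 2 : ℝ) ^ k / 2) ^ d) * V ≤
        ENNReal.ofReal (((1 / 2 : ℝ) ^ k / 2) ^ d) * (D * (M * 2 ^ d)) := by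
      refine h2.trans (le_of_eq ?_)
      ring
    exact (ENNReal.mul_le_mul_iff_right (ENNReal.ofReal_pos.2 (by positivity)).ne'
      ENNReal.ofReal_ne_top).1 h3
  have hr0 : Tendsto (fun k : ℕ => (1 / 2 : ℝ) ^ k / 2) atTop (𝓝 0) := by
    simpa using (tendsto_pow_atTop_nhds_zero_of_lt_one (r := (1 / 2 : ℝ)) (by norm_num)
      (by norm_num)).div_const 2
  have hlim : Tendsto (fun k : ℕ => volume (Metric.cthickening ((1 / 2) ^ k / 2) (Set.range f)) *
      (M * 2 ^ d)) atTop (𝓝 (volume (Set.range f) * (M * 2 ^ d))) := by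
    refine ENNReal.Tendsto.mul_const ((tendsto_measure_cthickening_of_isCompact hcomp).comp hr0) ?_
    exact Or.inr (ENNReal.mul_ne_top hM (by simp))
  have hle : V ≤ volume (Set.range f) * (M * 2 ^ d) := ge_of_tendsto_of_frequently hlim hlow
  by_contra! h0
  rw [nonpos_iff_eq_zero.1 h0, zero_mul] at hle
  exact hV0 (nonpos_iff_eq_zero.1 hle)

/-! ### Expected pair correlations of a Frostman measure -/

theorem sum_measure_cyl_le_one {m : ℕ} (μ : Measure (ℕ → Fin m)) [IsProbabilityMeasure μ] (n : ℕ) :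
    ∑ w : Fin n → Fin m, μ (cyl w) ≤ 1 := by
  rw [← measure_univ (μ := μ)]
  refine sum_measure_le_measure_univ (fun w _ => (measurableSet_cyl w).nullMeasurableSet)
    fun w _ w' _ hww' => Disjoint.aedisjoint (Set.disjoint_left.2 fun i hi hi' => hww' ?_)
  funext k
  rw [← hi k, ← hi' k]

/-- Cylinders of small measure make the diagonal null for the product measure. -/
theorem ae_ne_of_measure_cyl_le {m : ℕ} (μ : Measure (ℕ → Fin m)) [IsProbabilityMeasure μ]
    {u : ℕ → ℝ≥0∞} (hu : Tendsto u atTop (𝓝 0))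
    (hμ : ∀ (n : ℕ) (w : Fin n → Fin m), μ (cyl w) ≤ u n) :
    ∀ᵐ p ∂(μ.prod μ), p.1 ≠ p.2 := by
  have hle : ∀ n, (μ.prod μ) {p | ¬ p.1 ≠ p.2} ≤ u n := by
    intro n
    have hsub : {p : (ℕ → Fin m) × (ℕ → Fin m) | ¬ p.1 ≠ p.2} ⊆
        ⋃ w : Fin n → Fin m, cyl w ×ˢ cyl w := by
      rintro ⟨i, j⟩ hij
      obtain rfl : i = j := not_not.1 hij
      exact Set.mem_iUnion.2 ⟨fun k => i k, fun k => rfl, fun k => rfl⟩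
    calc _ ≤ ∑ w : Fin n → Fin m, (μ.prod μ) (cyl w ×ˢ cyl w) :=
          (measure_mono hsub).trans (measure_iUnion_fintype_le _ _)
      _ ≤ ∑ w : Fin n → Fin m, u n * μ (cyl w) := Finset.sum_le_sum fun w _ => by
          rw [Measure.prod_prod]
          exact mul_le_mul_left (hμ n w) _
      _ ≤ u n := by
          rw [← Finset.mul_sum]
          exact mul_le_of_le_one_right' (sum_measure_cyl_le_one μ n)
  exact nonpos_iff_eq_zero.1 (ge_of_tendsto' hu hle)

theorem exists_first_ne {α : Type*} {i j : ℕ → α} (h : i ≠ j) :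
    ∃ n, i n ≠ j n ∧ ∀ k < n, i k = j k := by
  classical
  have hex : ∃ n, i n ≠ j n := Function.ne_iff.1 h
  exact ⟨Nat.find hex, Nat.find_spec hex, fun k hk => not_not.1 (Nat.find_min hex hk)⟩

theorem measurableSet_pairs {d m : ℕ} (T : Fin m → Space d →L[ℝ] Space d)
    (a : Fin m → Space d) (r : ℝ) :
    MeasurableSet {q : (Word m → Space d) × ((ℕ → Fin m) × (ℕ → Fin m)) |
      dist (codingMap T a q.1 q.2.1) (codingMap T a q.1 q.2.2) ≤ r} := by
  have h1 : Measurable fun q : (Word m → Space d) × ((ℕ → Fin m) × (ℕ → Fin m)) =>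
      (q.1, q.2.1) := measurable_fst.prodMk (measurable_fst.comp measurable_snd)
  have h2 : Measurable fun q : (Word m → Space d) × ((ℕ → Fin m) × (ℕ → Fin m)) =>
      (q.1, q.2.2) := measurable_fst.prodMk (measurable_snd.comp measurable_snd)
  have h3 := (measurable_codingMap T a).comp h1
  have h4 := (measurable_codingMap T a).comp h2
  have h5 := measurableSet_le (h3.dist h4) (measurable_const (a := r))
  exact h5

theorem measurable_codingMap_right {d m : ℕ} (T : Fin m → Space d →L[ℝ] Space d)
    (a : Fin m → Space d) (y : Word m → Space d) : Measurable (codingMap T a y) := by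
  have h := (measurable_codingMap T a).comp
    (measurable_prodMk_left (x := y) : Measurable fun i : ℕ → Fin m => (y, i))
  exact h

/-- The mass that `μ × μ` gives to the pairs of words coded within distance `r`. -/
noncomputable def pairMass {d m : ℕ} (T : Fin m → Space d →L[ℝ] Space d) (a : Fin m → Space d)
    (μ : Measure (ℕ → Fin m)) (r : ℝ) (y : Word m → Space d) : ℝ≥0∞ :=
  (μ.prod μ) {p | dist (codingMap T a y p.1) (codingMap T a y p.2) ≤ r}

theorem measurable_pairMass {d m : ℕ} (T : Fin m → Space d →L[ℝ] Space d) (a : Fin m → Space d)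
    (μ : Measure (ℕ → Fin m)) [IsProbabilityMeasure μ] (r : ℝ) :
    Measurable (pairMass T a μ r) := by
  have h := measurable_measure_prodMk_left (ν := μ.prod μ) (measurableSet_pairs T a r)
  exact h

/-- The expected mass of the pairs coded within distance `r` is of order `r ^ q`, for a Frostman
measure of an exponent `s'` beyond `s`: pairs with common prefix `w` contribute at most
`μ[w] ^ 2 r ^ q / φ^s(T_w)`, and the sum over `w` is dominated by a geometric series. -/
theorem exists_lintegral_pairMass_le {d m : ℕ} (hd : 1 ≤ d) (hm : 1 ≤ m)
    {T : Fin m → Space d →L[ℝ] Space d} (hTu : ∀ i, IsUnit (T i)) (hT : ∀ i, ‖T i‖ < 1)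
    (a : Fin m → Space d) {η : Measure (Space d)} [IsProbabilityMeasure η]
    (hη : HasBoundedDensity η) (hη' : HasSuperpolynomialDecay η) {s s' q : ℝ}
    (hs0 : 0 < s) (hs : s ≤ d) (hq0 : 0 < q) (hqs : q < s ∨ q = s ∧ s = d) (hss' : s < s')
    {μ : Measure (ℕ → Fin m)} [IsProbabilityMeasure μ] {C : ℝ} (hC : 0 < C)
    (hμ : ∀ (n : ℕ) (w : Fin n → Fin m),
      μ (cyl w) ≤ ENNReal.ofReal (C * singularValueFunction s' (wordProd T w))) :
    ∃ M : ℝ, 0 < M ∧ ∀ r : ℝ, 0 < r → r ≤ 1 →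
      ∫⁻ y, pairMass T a μ r y ∂(perturbationLaw m η) ≤ ENNReal.ofReal (M * r ^ q) := by
  obtain ⟨L, hL0, hL1, hL⟩ := exists_norm_le_lt_one hT
  obtain ⟨K, hK, hKb⟩ := exists_measure_norm_le hd hη hη' hs0 hs hq0 hqs
  have hpr : IsProbabilityMeasure (perturbationLaw m η) := by
    unfold perturbationLaw; infer_instance
  set ρ := L ^ (s' - s) with hρ
  have hρ0 : 0 < ρ := by positivity
  have hρ1 : ρ < 1 := Real.rpow_lt_one hL0.le hL1 (sub_pos.2 hss')
  have hφ0 : ∀ {n : ℕ} (w : Fin n → Fin m), 0 < singularValueFunction s (wordProd T w) :=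
    fun w => singularValueFunction_pos hs0 (isUnit_wordProd hTu w)
  have hnorm1 : ∀ {n : ℕ} (w : Fin n → Fin m), ‖wordProd T w‖ ≤ 1 := fun w =>
    (norm_wordProd_le hL0.le hL w).trans (pow_le_one₀ hL0.le hL1.le)
  have hφρ : ∀ {n : ℕ} (w : Fin n → Fin m), singularValueFunction s' (wordProd T w) ≤
      ρ ^ n * singularValueFunction s (wordProd T w) := fun w =>
    singularValueFunction_wordProd_le_mul hd hTu hL0.le hL hs0 hss'.le w
  have hne : ∀ᵐ p ∂(μ.prod μ), p.1 ≠ p.2 := by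
    refine ae_ne_of_measure_cyl_le μ (u := fun n => ENNReal.ofReal (C * ρ ^ n)) ?_ fun n w => ?_
    · rw [← ENNReal.ofReal_zero]
      refine ENNReal.tendsto_ofReal ?_
      simpa using (tendsto_pow_atTop_nhds_zero_of_lt_one hρ0.le hρ1).const_mul C
    · refine (hμ n w).trans (ENNReal.ofReal_le_ofReal ?_)
      refine mul_le_mul_of_nonneg_left ((hφρ w).trans ?_) hC.le
      exact mul_le_of_le_one_right (by positivity) (singularValueFunction_le_one hs0 (hnorm1 w))
  refine ⟨K * C / (1 - ρ), div_pos (by positivity) (sub_pos.2 hρ1), fun r hr0 hr1 => ?_⟩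
  set G : ∀ n : ℕ, (Fin n → Fin m) → ℝ≥0∞ := fun n w =>
    ENNReal.ofReal (K * r ^ q / singularValueFunction s (wordProd T w)) with hG
  have hS := measurableSet_pairs T a r
  have h1 : ∫⁻ y, pairMass T a μ r y ∂(perturbationLaw m η) =
      ∫⁻ p, (perturbationLaw m η) {y | dist (codingMap T a y p.1) (codingMap T a y p.2) ≤ r}
        ∂(μ.prod μ) := by
    have e1 := Measure.prod_apply (μ := perturbationLaw m η) (ν := μ.prod μ) hS
    have e2 := Measure.prod_apply_symm (μ := perturbationLaw m η) (ν := μ.prod μ) hS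
    exact e1.symm.trans e2
  have h2 : ∀ᵐ p ∂(μ.prod μ),
      (perturbationLaw m η) {y | dist (codingMap T a y p.1) (codingMap T a y p.2) ≤ r} ≤
      ∑' n : ℕ, ∑ w : Fin n → Fin m, (cyl w ×ˢ cyl w).indicator (fun _ => G n w) p := by
    filter_upwards [hne] with p hp
    obtain ⟨n, hn, hk⟩ := exists_first_ne hp
    simp_rw [dist_eq_norm]
    set w : Fin n → Fin m := fun k => p.1 k
    have hb := measure_norm_codingMap_sub_le hm hT a η hη' hn
      fun c => hKb (prefixProd T p.1 n) (isUnit_wordProd hTu _) (hnorm1 _) c r hr0 hr1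
    refine hb.trans ?_
    refine le_trans ?_ (ENNReal.le_tsum n)
    refine le_trans ?_ (Finset.single_le_sum (f := fun w : Fin n → Fin m =>
      (cyl w ×ˢ cyl w).indicator (fun _ => G n w) p) (fun _ _ => zero_le) (Finset.mem_univ w))
    have hmem : p ∈ cyl w ×ˢ cyl w := ⟨fun k => rfl, fun k => (hk k k.2).symm⟩
    simp only [Set.indicator_of_mem hmem]
    exact le_rfl
  rw [h1]
  refine (lintegral_mono_ae h2).trans ?_
  have hmc : ∀ (n : ℕ) (w : Fin n → Fin m), MeasurableSet (cyl w ×ˢ cyl w) := fun n w =>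
    (measurableSet_cyl w).prod (measurableSet_cyl w)
  rw [lintegral_tsum fun n => (Finset.measurable_sum _ fun w _ =>
    measurable_const.indicator (hmc n w)).aemeasurable]
  have h3 : ∀ n : ℕ, ∫⁻ p, ∑ w : Fin n → Fin m,
      (cyl w ×ˢ cyl w).indicator (fun _ => G n w) p ∂(μ.prod μ) ≤
      ENNReal.ofReal (K * C * r ^ q * ρ ^ n) := by
    intro n
    rw [lintegral_finsetSum _ fun w _ => measurable_const.indicator (hmc n w)]
    calc _ ≤ ∑ w : Fin n → Fin m, ENNReal.ofReal (K * C * r ^ q * ρ ^ n) * μ (cyl w) := by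
          refine Finset.sum_le_sum fun w _ => ?_
          rw [lintegral_indicator_const (hmc n w), Measure.prod_prod, ← mul_assoc]
          refine mul_le_mul_left ((mul_le_mul_right (hμ n w) _).trans ?_) _
          have hφ := hφ0 w
          rw [hG, ← ENNReal.ofReal_mul (by positivity)]
          refine ENNReal.ofReal_le_ofReal ?_
          calc _ ≤ K * r ^ q / singularValueFunction s (wordProd T w) *
                (C * (ρ ^ n * singularValueFunction s (wordProd T w))) := by
                gcongr
                exact hφρ w
            _ = _ := by field_simp
      _ ≤ _ := by
          rw [← Finset.mul_sum]
          exact mul_le_of_le_one_right' (sum_measure_cyl_le_one μ n)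
  refine (ENNReal.tsum_le_tsum h3).trans (le_of_eq ?_)
  rw [← ENNReal.ofReal_tsum_of_nonneg (fun n => by positivity)
    ((summable_geometric_of_lt_one hρ0.le hρ1).mul_left _), tsum_mul_left,
    tsum_geometric_of_lt_one hρ0.le hρ1]
  congr 1
  ring

/-- Finite energy at every exponent below the affinity dimension, almost surely. -/
theorem ae_le_dimH_attractor {d m : ℕ} (hd : 1 ≤ d) (hm : 1 ≤ m)
    {T : Fin m → Space d →L[ℝ] Space d} (hTu : ∀ i, IsUnit (T i)) (hT : ∀ i, ‖T i‖ < 1)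
    (a : Fin m → Space d) {η : Measure (Space d)} [IsProbabilityMeasure η]
    (hη : HasBoundedDensity η) (hη' : HasSuperpolynomialDecay η)
    (hdim : affinityDim T ≤ (d : ℝ≥0∞)) {t : ℝ≥0} (ht0 : 0 < t) (ht : (t : ℝ≥0∞) < affinityDim T) :
    ∀ᵐ y ∂(perturbationLaw m η), (t : ℝ≥0∞) ≤ dimH (attractor T a y) := by
  obtain ⟨x, hx1, hx2⟩ := ENNReal.lt_iff_exists_nnreal_btwn.1 ht
  have htx : (t : ℝ) < x := by exact_mod_cast hx1
  obtain ⟨s', hs'1, hs'2⟩ := exists_between htx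
  obtain ⟨s, hs1, hs2⟩ := exists_between hs'1
  obtain ⟨q, hq1, hq2⟩ := exists_between hs1
  have ht0' : (0 : ℝ) < t := ht0
  have hq0 : 0 < q := ht0'.trans hq1
  have hs0 : 0 < s := hq0.trans hq2
  have hs'0 : 0 < s' := hs0.trans hs2
  have hxd : (x : ℝ) ≤ d := by
    have := hx2.le.trans hdim
    exact_mod_cast this
  obtain ⟨μ, hμ, C, hC, hμC⟩ := exists_frostman_measure hd hm hTu hT hs'0 hs'2
    (not_summable_of_lt_affinityDim (hs'0.trans hs'2) (by rwa [ENNReal.ofReal_coe_nnreal]))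
  obtain ⟨M, hM, hMr⟩ := exists_lintegral_pairMass_le hd hm hTu hT a hη hη' hs0
    ((hs2.trans hs'2).le.trans hxd) hq0 (Or.inl hq2) hs2 hC hμC
  have hfin : ∫⁻ y, ∑' k : ℕ, ENNReal.ofReal ((2 ^ (t : ℝ)) ^ k) *
      pairMass T a μ ((1 / 2) ^ k) y ∂(perturbationLaw m η) ≠ ∞ := by
    rw [lintegral_tsum fun k => ((measurable_pairMass T a μ _).const_mul _).aemeasurable]
    have h1 : ∀ k : ℕ, ∫⁻ y, ENNReal.ofReal ((2 ^ (t : ℝ)) ^ k) *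
        pairMass T a μ ((1 / 2) ^ k) y ∂(perturbationLaw m η) ≤
        ENNReal.ofReal (M * (2 ^ ((t : ℝ) - q)) ^ k) := by
      intro k
      rw [lintegral_const_mul _ (measurable_pairMass T a μ _)]
      refine (mul_le_mul_right (hMr _ (by positivity)
        (pow_le_one₀ (by norm_num) (by norm_num))) _).trans ?_
      rw [← ENNReal.ofReal_mul (by positivity)]
      refine ENNReal.ofReal_le_ofReal (le_of_eq ?_)
      have e : ((1 / 2 : ℝ) ^ k) ^ q = ((2 : ℝ) ^ (-q)) ^ k := by
        rw [Real.rpow_neg zero_le_two, ← Real.inv_rpow zero_le_two, ← Real.rpow_natCast,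
          ← Real.rpow_natCast, ← Real.rpow_mul (by norm_num), ← Real.rpow_mul (by norm_num),
          mul_comm q]
        norm_num
      rw [e, sub_eq_add_neg, Real.rpow_add two_pos, mul_pow]
      ring
    refine ne_top_of_le_ne_top ?_ (ENNReal.tsum_le_tsum h1)
    have h2 : (2 : ℝ) ^ ((t : ℝ) - q) < 1 :=
      Real.rpow_lt_one_of_one_lt_of_neg one_lt_two (sub_neg.2 hq1)
    rw [← ENNReal.ofReal_tsum_of_nonneg (fun n => by positivity)
      ((summable_geometric_of_lt_one (by positivity) h2).mul_left _)]
    exact ENNReal.ofReal_ne_top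
  have hae := ae_lt_top (Measurable.tsum fun k : ℕ =>
    (measurable_pairMass T a μ ((1 / 2) ^ k)).const_mul (ENNReal.ofReal ((2 ^ (t : ℝ)) ^ k))) hfin
  filter_upwards [hae] with y hy
  have hf := measurable_codingMap_right T a y
  have hSm : ∀ k : ℕ, MeasurableSet {p : (ℕ → Fin m) × (ℕ → Fin m) |
      dist (codingMap T a y p.1) (codingMap T a y p.2) ≤ (1 / 2) ^ k} := fun k =>
    measurableSet_le ((hf.comp measurable_fst).dist (hf.comp measurable_snd)) measurable_const
  refine le_dimH_range_of_energy μ hf ht0 ?_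
  have hmk : ∀ k : ℕ, Measurable fun i => μ {j | dist (codingMap T a y i) (codingMap T a y j) ≤
      (1 / 2) ^ k} := fun k => measurable_measure_prodMk_left (hSm k)
  rw [lintegral_tsum fun k => ((hmk k).const_mul _).aemeasurable]
  refine ne_of_lt (lt_of_le_of_lt (le_of_eq ?_) hy)
  refine tsum_congr fun k => ?_
  rw [lintegral_const_mul _ (hmk k), pairMass, Measure.prod_apply (hSm k)]
  rfl

theorem ae_volume_attractor_pos {d m : ℕ} (hd : 1 ≤ d) (hm : 1 ≤ m)
    {T : Fin m → Space d →L[ℝ] Space d} (hTu : ∀ i, IsUnit (T i)) (hT : ∀ i, ‖T i‖ < 1)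
    (a : Fin m → Space d) {η : Measure (Space d)} [IsProbabilityMeasure η]
    (hη : HasBoundedDensity η) (hη' : HasSuperpolynomialDecay η)
    (hdim : (d : ℝ≥0∞) < affinityDim T) :
    ∀ᵐ y ∂(perturbationLaw m η), 0 < volume (attractor T a y) := by
  have hd0 : (0 : ℝ) < d := by exact_mod_cast hd
  have hpr : IsProbabilityMeasure (perturbationLaw m η) := by
    unfold perturbationLaw; infer_instance
  obtain ⟨x, hx1, hx2⟩ := ENNReal.lt_iff_exists_nnreal_btwn.1 hdim
  have hdx : (d : ℝ) < x := by exact_mod_cast hx1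
  obtain ⟨s', hs'1, hs'2⟩ := exists_between hdx
  have hs'0 : 0 < s' := hd0.trans hs'1
  obtain ⟨μ, hμ, C, hC, hμC⟩ := exists_frostman_measure hd hm hTu hT hs'0 hs'2
    (not_summable_of_lt_affinityDim (hs'0.trans hs'2) (by rwa [ENNReal.ofReal_coe_nnreal]))
  obtain ⟨M, hM, hMr⟩ := exists_lintegral_pairMass_le hd hm hTu hT a hη hη' hd0
    le_rfl hd0 (Or.inr ⟨rfl, rfl⟩) hs'1 hC hμC
  set F : ℕ → (Word m → Space d) → ℝ≥0∞ := fun k y =>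
    (ENNReal.ofReal (((1 / 2) ^ k) ^ d))⁻¹ * pairMass T a μ ((1 / 2) ^ k) y with hF
  have hFm : ∀ k, Measurable (F k) := fun k => (measurable_pairMass T a μ _).const_mul _
  have hpos : ∀ k : ℕ, ENNReal.ofReal (((1 / 2 : ℝ) ^ k) ^ d) ≠ 0 := fun k =>
    (ENNReal.ofReal_pos.2 (by positivity)).ne'
  have hFint : ∀ k, ∫⁻ y, F k y ∂(perturbationLaw m η) ≤ ENNReal.ofReal M := by
    intro k
    rw [lintegral_const_mul _ (measurable_pairMass T a μ _),
      ENNReal.inv_mul_le_iff (hpos k) ENNReal.ofReal_ne_top]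
    refine (hMr _ (by positivity) (pow_le_one₀ (by norm_num) (by norm_num))).trans (le_of_eq ?_)
    rw [Real.rpow_natCast, mul_comm, ENNReal.ofReal_mul (by positivity)]
  have hlim : ∫⁻ y, liminf (fun k => F k y) atTop ∂(perturbationLaw m η) ≠ ∞ := by
    refine ne_top_of_le_ne_top (ENNReal.ofReal_ne_top (r := M)) ((lintegral_liminf_le hFm).trans ?_)
    refine liminf_le_of_le (by isBoundedDefault) fun b hb => ?_
    obtain ⟨k, hk⟩ := hb.exists
    exact hk.trans (hFint k)
  filter_upwards [ae_lt_top (Measurable.liminf hFm) hlim, ae_exists_growthBound_mul_lt_one hm hT a η hη'] with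
    y hy ⟨B, τ, L, hB, hτ, hL0, hL, hLτ, hgb⟩
  have hcont := hgb.continuous_codingMap hL0.le (zero_le_one.trans hτ.le) hL hLτ
  obtain ⟨N, hN⟩ := ENNReal.exists_nat_gt hy.ne
  refine volume_range_pos_of_pairs μ (measurable_codingMap_right T a y) (isCompact_range hcont)
    (ENNReal.natCast_ne_top N) ((frequently_lt_of_liminf_lt (by isBoundedDefault) hN).mono
    fun k hk => ?_)
  have h1 := hk.le
  simp only [hF] at h1
  rw [ENNReal.inv_mul_le_iff (hpos k) ENNReal.ofReal_ne_top, mul_comm] at h1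
  exact h1

theorem ae_dimH_attractor_eq {d m : ℕ} (hd : 1 ≤ d) (hm : 1 ≤ m)
    {T : Fin m → Space d →L[ℝ] Space d} (hTu : ∀ i, IsUnit (T i)) (hT : ∀ i, ‖T i‖ < 1)
    (a : Fin m → Space d) {η : Measure (Space d)} [IsProbabilityMeasure η]
    (hη : HasBoundedDensity η) (hη' : HasSuperpolynomialDecay η)
    (hdim : affinityDim T ≤ (d : ℝ≥0∞)) :
    ∀ᵐ y ∂(perturbationLaw m η), dimH (attractor T a y) = affinityDim T := by
  have hlow : ∀ᵐ y ∂(perturbationLaw m η), affinityDim T ≤ dimH (attractor T a y) := by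
    rcases eq_or_ne (affinityDim T) 0 with h0 | h0
    · rw [h0]
      exact Eventually.of_forall fun y => zero_le
    · obtain ⟨u, -, hu, hulim⟩ := exists_seq_strictMono_tendsto' (pos_iff_ne_zero.2 h0)
      have hall : ∀ᵐ y ∂(perturbationLaw m η), ∀ n, u n ≤ dimH (attractor T a y) := by
        rw [ae_all_iff]
        intro n
        have hun := hu n
        lift u n to ℝ≥0 using (hun.2.trans_le le_top).ne with t
        exact ae_le_dimH_attractor hd hm hTu hT a hη hη' hdim (by exact_mod_cast hun.1) hun.2
      filter_upwards [hall] with y hy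
      exact le_of_tendsto' hulim hy
  filter_upwards [hlow, ae_dimH_attractor_le hd hm hTu hT a η hη'] with y h1 h2
  exact le_antisymm h2 h1

end RandomSelfAffine

theorem mainTheorem1 (d m : ℕ) (hd : 1 ≤ d) (hm : 1 ≤ m)
    (T : Fin m → RandomSelfAffine.Space d →L[ℝ] RandomSelfAffine.Space d)
    (hT_inv : ∀ i, IsUnit (T i)) (hT_norm : ∀ i, ‖T i‖ < 1)
    (a : Fin m → RandomSelfAffine.Space d)
    (η : Measure (RandomSelfAffine.Space d)) [IsProbabilityMeasure η]
    (hη_density : RandomSelfAffine.HasBoundedDensity η)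
    (hη_decay : RandomSelfAffine.HasSuperpolynomialDecay η) :
    (∀ᵐ y ∂(RandomSelfAffine.perturbationLaw m η), RandomSelfAffine.IsWellDefined T a y) ∧
    (RandomSelfAffine.affinityDim T ≤ (d : ℝ≥0∞) →
      ∀ᵐ y ∂(RandomSelfAffine.perturbationLaw m η),
        dimH (RandomSelfAffine.attractor T a y) = RandomSelfAffine.affinityDim T) ∧
    ((d : ℝ≥0∞) < RandomSelfAffine.affinityDim T →
      ∀ᵐ y ∂(RandomSelfAffine.perturbationLaw m η),
        0 < volume (RandomSelfAffine.attractor T a y)) := by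
  refine ⟨?_, RandomSelfAffine.ae_dimH_attractor_eq hd hm hT_inv hT_norm a hη_density hη_decay,
    RandomSelfAffine.ae_volume_attractor_pos hd hm hT_inv hT_norm a hη_density hη_decay⟩
  filter_upwards [RandomSelfAffine.ae_exists_growthBound_mul_lt_one hm hT_norm a η hη_decay] with
    y ⟨C, τ, L, _, hτ, hL0, hL, hLτ, hy⟩
  exact hy.isWellDefined hL0.le (zero_le_one.trans hτ.le) hL hLτ
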